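/- Let $\mathbb{D}$ be the open unit disc in $\mathbb{C}$ and let $dA$ be Lebesgue area measure on $\mathbb{D}$ normalized so that $A(\mathbb{D})=1$. A variable exponent on $\mathbb{D}$ is a measurable function $p:\mathbb{D}\to\mathbb{R}$ with $0<\operatorname{ess\,inf}p\le\operatorname{ess\,sup}p<\infty$. The Bergman space $A^{p(\cdot)}$ is the set of all analytic functions $f$ on $\mathbb{D}$ with $\int_{\mathbb{D}}|f(z)|^{p(z)}\,dA(z)<\infty$; for a constant $q>0$ this is the classical space $A^q$, with norm $\|f\|_{A^q}=\inf\{t>0:\int_{\mathbb{D}}|f/t|^{q}\,dA<1\}=\left(\int_{\mathbb{D}}|f|^q\,dA\right)^{1/q}$. For $s>0$ and $0\le r<1$ write $M_s^s(r,f)=\frac1{2\pi}\int_0^{2\pi}|f(re^{i\theta})|^s\,d\theta$. All integrals of nonnegative functions take values in $[0,\infty]$. **Theorem.** Let $q>0$, and let $p$ be a variable exponent on $\mathbb{D}$ that is radial, i.e. $p(z)=p(|z|)$ for all $z\in\mathbb{D}$, with $q\le p(z)$ for almost every $z\in\mathbb{D}$ (and $\operatorname{ess\,sup}p<\infty$).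 Then the following are equivalent. 1. $A^q=A^{p(\cdot)}$ as sets. 2. There is a constant $K<\infty$ such that for every $f\in A^q$ with $\|f\|_{A^q}=1$, $$\int_0^1 M_{p(r)}^{p(r)}(r,f)\,r\,dr\le K\int_0^1 M_q^q(r,f)\,r\,dr.$$ 3. There is a constant $K<\infty$ such that for every $f\in A^q$, $$\int_0^1\frac{1}{(1-r)^{2(p(r)-q)/q}}\,M_q^q(r,f)\,r\,dr\le K\int_0^1M_q^q(r,f)\,r\,dr.$$ 4. There is a constant $K<\infty$ such that for every nondecreasing, left continuous function $g:[0,1)\to[0,\infty)$, $$\int_0^1\frac{1}{(1-r)^{2(p(r)-q)/q}}\,g(r)\,dr\le K\int_0^1g(r)\,dr.$$ 5. There is a constant $K<\infty$ such that for all $0<x\le1$, $$\frac1x\int_{1-x}^1\frac{dr}{(1-r)^{2(p(r)-q)/q}}\le K.$$ 6. There is a constant $K<\infty$ such that for all $0<x\le1$, $$\frac2x\int_{1-x}^{1-x/2}\frac{dr}{(1-r)^{2(p(r)-q)/q}}\le K.$$ 7. For some real $a$ with $aq>2$ there is a constant $C'<\infty$ such that for all $\lambda\in\mathbb{D}$,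 $$\int_{\mathbb{D}}|K_{\lambda,a,q}(z)|^{p(z)}\,dA(z)\le C',\qquad K_{\lambda,a,q}(z)=\frac{(1-|\lambda|^2)^{a-2/q}}{(1-\overline{\lambda}z)^a}$$ (principal branch of the power). 8. For every real $a$ with $aq>2$ there is a constant $C'<\infty$ (which may depend on $a$) such that the inequality in 7 holds for all $\lambda\in\mathbb{D}$. Moreover, conditions 2 and 3 remain equivalent to all the others if the constant $K$ in either of them is allowed to depend on $f$. -/

import Mathlib

open MeasureTheory Set
open scoped ENNReal NNReal

noncomputable section

namespace VarBergman

/-- The open unit disc `𝔻` in `ℂ`. -/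
def disc : Set ℂ := Metric.ball 0 1

/-- Normalized Lebesgue area measure `dA` on the unit disc. -/
def dA : Measure ℂ := (ENNReal.ofReal Real.pi)⁻¹ • volume.restrict disc

/-- `p` is a variable exponent on the disc: a (Lebesgue) measurable function on `𝔻` with
`0 < ess inf p ≤ ess sup p < ∞`. The values of `p` outside the disc play no role. -/
structure IsVariableExponent (p : ℂ → ℝ) : Prop where
  aemeasurable : AEMeasurable p dA
  essInf_pos : 0 < essInf (fun z => (p z : EReal)) dA
  essSup_lt_top : essSup (fun z => (p z : EReal)) dA < ⊤

/-- `p` is radial: `p z = p |z|` for all `z` in the disc. -/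
def IsRadial (p : ℂ → ℝ) : Prop := ∀ z ∈ disc, p z = p (‖z‖ : ℂ)

/-- The modular `ρ_{p(·)}(f) = ∫_𝔻 |f(z)|^{p(z)} dA(z)`, with values in `[0, ∞]`. -/
def modular (p : ℂ → ℝ) (f : ℂ → ℂ) : ℝ≥0∞ := ∫⁻ z, ‖f z‖ₑ ^ p z ∂dA

/-- The (Luxemburg–Nakano) norm `inf {t > 0 : ρ_{p(·)}(f / t) < 1}`. -/
def luxNorm (p : ℂ → ℝ) (f : ℂ → ℂ) : ℝ :=
  sInf {t : ℝ | 0 < t ∧ modular p (fun z => f z / (t : ℂ)) < 1}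

/-- The Bergman space `A^{p(·)}`: all functions analytic in the disc with finite modular.
(Functions are represented by arbitrary extensions to `ℂ`.) For a constant exponent this
is the classical space `A^q`. -/
def bergman (p : ℂ → ℝ) : Set (ℂ → ℂ) :=
  {f | AnalyticOnNhd ℂ f disc ∧ modular p f < ⊤}

/-- `M_s^s(r, f) = (1 / 2π) ∫_0^{2π} |f(r e^{iθ})|^s dθ`, with values in `[0, ∞]`. -/
def meanPow (s r : ℝ) (f : ℂ → ℂ) : ℝ≥0∞ :=
  (ENNReal.ofReal (2 * Real.pi))⁻¹ *
    ∫⁻ θ in Ioc (0 : ℝ) (2 * Real.pi), ‖f (circleMap 0 r θ)‖ₑ ^ s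

/-- The weight `1 / (1 - r)^{2 (p(r) - q) / q}`. -/
def weight (p : ℂ → ℝ) (q r : ℝ) : ℝ≥0∞ :=
  ENNReal.ofReal (1 / (1 - r) ^ (2 * (p (r : ℂ) - q) / q))

/-- The function `K_{w,a,q}(z) = (1 - |w|²)^{a - 2/q} / (1 - w̄ z)^a` (principal branch;
`1 - w̄ z` has positive real part for `w, z` in the disc). -/
def kernelFun (w : ℂ) (a q : ℝ) (z : ℂ) : ℂ :=
  (((1 - ‖w‖ ^ 2) ^ (a - 2 / q) : ℝ) : ℂ) / (1 - (starRingEnd ℂ) w * z) ^ (a : ℂ)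

end VarBergman

end

namespace VarBergman

open Real Metric Filter

/-! Everything reduces to one condition on the weight W(r) = (1-r)^(-2(p(r)-q)/q): its averages over
the shells `[1-x, 1-x/2]` are bounded.

Sufficiency. Summing dyadic shells bounds the averages of W over `[1-x, 1)`. A nondecreasing g on
(0,1) has superlevel sets that are intervals ending at 1, so the layer cake formula bounds the
integral of Wg by K times that of g. Hardy's theorem makes r M_q^q(r,f) such a function
(`lintegral_mul_meanPow_le`). Finally, point evaluations give |f(z)|^q ≤ ‖f‖^q (1-|z|)^(-2); applied
to the factor |f|^(p-q) of |f|^p, this produces exactly the weight (`enorm_rpow_le_weight_mul`).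
Normalizing f then yields A^q ⊆ A^(p(·)); the reverse inclusion holds because the area measure is
finite and q ≤ p.

Necessity. The kernel with parameter w = 1-x is bounded in A^q and is of size at least a constant
times x^(-2/q) on a sector of dimensions about x by x at the shell. There |K|^p is at least a
constant times x^(-2) W, so the modular of K controls the average of W (`shell_average_le_modular`).
When only the equality of sets is known, a gliding hump replaces uniform bounds: if the averages
were unbounded, a series of kernels with coefficients 4^(-n), at shells chosen with fast growing
averages, would lie in A^q but not in A^(p(·)). Near the positive radius all these kernels have
positive real part, so terms cannot cancel (`le_norm_kernelSeries`). -/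

/-! ### Subharmonicity and monotone integral means. -/

/-- The zeros of an analytic function that does not vanish at the centre of a disc are negligible
on the boundary circle. -/
theorem ae_circleMap_ne_zero {f : ℂ → ℂ} {c : ℂ} {R : ℝ} (hR : R ≠ 0)
    (hf : AnalyticOnNhd ℂ f (closedBall c |R|)) (hfc : f c ≠ 0) :
    ∀ᵐ θ ∂volume.restrict (Ioc 0 (2 * π)), f (circleMap c R θ) ≠ 0 := by
  have hc : c ∈ closedBall c |R| := by simp
  rcases hf.eqOn_zero_or_eventually_ne_zero_of_preconnected
    (convex_closedBall c |R|).isPreconnected with h | h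
  · exact absurd (h hc) hfc
  · apply ae_restrict_le_codiscreteWithin measurableSet_Ioc
    exact codiscreteWithin_mono (subset_univ _)
      (circleMap_preimage_codiscrete hR (codiscreteWithin_mono sphere_subset_closedBall h))

/-- The logarithm of the modulus of an analytic function has the sub-mean value property. -/
theorem log_norm_le_circleAverage {f : ℂ → ℂ} {c : ℂ} {R : ℝ} (hR : 0 < R)
    (hf : AnalyticOnNhd ℂ f (closedBall c R)) (hfc : f c ≠ 0) :
    Real.log ‖f c‖ ≤ circleAverage (fun z => Real.log ‖f z‖) c R := by
  have hf' : AnalyticOnNhd ℂ f (closedBall c |R|) := by rwa [abs_of_pos hR]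
  rw [hf'.circleAverage_log_norm hR.ne' hfc, le_add_iff_nonneg_left]
  refine finsum_nonneg fun u => ?_
  by_cases hu : u ∈ closedBall c |R|
  · refine mul_nonneg ?_ ?_
    · exact_mod_cast (MeromorphicOn.AnalyticOnNhd.divisor_nonneg hf') u
    · rcases eq_or_ne c u with rfl | hcu
      · simp
      · refine Real.log_nonneg ?_
        have h0 : 0 < ‖c - u‖ := norm_pos_iff.2 (sub_ne_zero.2 hcu)
        rw [mem_closedBall, dist_comm, dist_eq_norm, abs_of_pos hR] at hu
        rw [← div_eq_mul_inv, one_le_div h0]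
        exact hu
  · simp [hu]

theorem circleIntegrable_norm_rpow {f : ℂ → ℂ} {c : ℂ} {R q : ℝ} (hR : 0 ≤ R) (hq : 0 < q)
    (hf : ContinuousOn f (closedBall c R)) : CircleIntegrable (fun z => ‖f z‖ ^ q) c R := by
  refine ContinuousOn.circleIntegrable hR ?_
  exact ((hf.mono sphere_subset_closedBall).norm).rpow_const fun _ _ => Or.inr hq.le

/-- Positive powers of the modulus of an analytic function have the sub-mean value property. -/
theorem norm_rpow_le_circleAverage {f : ℂ → ℂ} {c : ℂ} {R q : ℝ} (hR : 0 < R) (hq : 0 < q)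
    (hf : AnalyticOnNhd ℂ f (closedBall c R)) :
    ‖f c‖ ^ q ≤ circleAverage (fun z => ‖f z‖ ^ q) c R := by
  rcases eq_or_ne (f c) 0 with h0 | h0
  · rw [h0, norm_zero, zero_rpow hq.ne']
    exact circleAverage_nonneg_of_nonneg fun z _ => by positivity
  have hf' : AnalyticOnNhd ℂ f (closedBall c |R|) := by rwa [abs_of_pos hR]
  have hlog := log_norm_le_circleAverage hR hf h0
  have hlogint : CircleIntegrable (fun z => Real.log ‖f z‖) c R :=
    (hf'.mono sphere_subset_closedBall).meromorphicOn.circleIntegrable_log_norm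
  set A : ℝ := ‖f c‖ ^ q
  have hA : 0 ≤ A := by positivity
  -- Jensen's inequality by hand: the integrand is the tangent line of u ↦ exp(qu) at u = log ‖f c‖,
  -- evaluated at log ‖f z‖, hence lies below ‖f z‖^q wherever f does not vanish.
  have hg : circleAverage (fun z => A * q * Real.log ‖f z‖ + (A - A * q * Real.log ‖f c‖)) c R =
      A * q * circleAverage (fun z => Real.log ‖f z‖) c R + (A - A * q * Real.log ‖f c‖) := by
    have := circleAverage_fun_add (f₁ := fun z => A * q * Real.log ‖f z‖)
      (hlogint.const_fun_smul (a := A * q)) (circleIntegrable_const (A - A * q * Real.log ‖f c‖) _ _)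
    rw [this, circleAverage_const]
    congr 1
    exact circleAverage_fun_smul (a := A * q)
  have hle : circleAverage (fun z => A * q * Real.log ‖f z‖ + (A - A * q * Real.log ‖f c‖)) c R ≤
      circleAverage (fun z => ‖f z‖ ^ q) c R := by
    simp only [circleAverage_def]
    refine smul_le_smul_of_nonneg_left ?_ (by positivity)
    refine intervalIntegral.integral_mono_ae_restrict (by positivity) ?_ ?_ ?_
    · exact (hlogint.const_fun_smul (a := A * q)).add (circleIntegrable_const _ _ _)
    · exact circleIntegrable_norm_rpow hR.le hq hf.continuousOn
    · rw [← restrict_Ioc_eq_restrict_Icc]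
      filter_upwards [ae_circleMap_ne_zero hR.ne' hf' h0] with θ hθ
      set t := ‖f (circleMap c R θ)‖ with ht
      have htpos : 0 < t := norm_pos_iff.2 hθ
      have h1 : A * (1 + (q * (Real.log t - Real.log ‖f c‖))) ≤ t ^ q := by
        have h2 : t ^ q = A * Real.exp (q * (Real.log t - Real.log ‖f c‖)) := by
          rw [rpow_def_of_pos htpos]
          simp only [A]
          rw [rpow_def_of_pos (norm_pos_iff.2 h0), ← Real.exp_add]
          ring_nf
        rw [h2]
        gcongr
        linarith [Real.add_one_le_exp (q * (Real.log t - Real.log ‖f c‖))]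
      calc _ = A * (1 + (q * (Real.log t - Real.log ‖f c‖))) := by ring
        _ ≤ _ := h1
  have : 0 ≤ A * q := by positivity
  nlinarith [mul_le_mul_of_nonneg_left hlog this]

/-- The average exceeds the value at the centre by R². This strict gain makes ε‖z‖² a suitable
perturbation for the maximum principle in `monotoneOn_mean`. -/
theorem circleAverage_norm_sq (c : ℂ) (R : ℝ) :
    circleAverage (fun z => ‖z‖ ^ 2) c R = ‖c‖ ^ 2 + R ^ 2 := by
  have h : ∀ θ : ℝ, ‖circleMap c R θ‖ ^ 2 =
      ‖c‖ ^ 2 + R ^ 2 + 2 * R * c.re * cos θ + 2 * R * c.im * sin θ := by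
    intro θ
    rw [← Complex.normSq_eq_norm_sq, ← Complex.normSq_eq_norm_sq]
    simp only [circleMap, Complex.normSq_apply, Complex.add_re, Complex.add_im, Complex.exp_mul_I,
      Complex.mul_re, Complex.mul_im, Complex.ofReal_re, Complex.ofReal_im, Complex.I_re,
      Complex.I_im, ← Complex.ofReal_cos, ← Complex.ofReal_sin]
    nlinarith [Real.sin_sq_add_cos_sq θ]
  simp only [circleAverage_def, h]
  rw [intervalIntegral.integral_add, intervalIntegral.integral_add]
  · simp
    field_simp
  all_goals exact Continuous.intervalIntegrable (by fun_prop) _ _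

/-- The integral mean of `‖f‖ ^ q` over the circle through `z`, as an average over rotations. -/
theorem circleAverage_norm_eq_rotation (φ : ℂ → ℝ) (z : ℂ) :
    circleAverage φ 0 ‖z‖ =
      (2 * π)⁻¹ * ∫ α in (0 : ℝ)..2 * π, φ (Complex.exp (α * Complex.I) * z) := by
  rw [circleAverage_eq_integral_add z.arg, smul_eq_mul]
  congr 2
  ext α
  congr 1
  conv_rhs => rw [← Complex.norm_mul_exp_arg_mul_I z]
  simp only [circleMap, Complex.ofReal_add, add_mul, Complex.exp_add]
  ring

/-- The integral means of `‖f‖ ^ q`, as a radial function, have the sub-mean value property. -/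
theorem mean_le_circleAverage_mean {f : ℂ → ℂ} {c : ℂ} {R q : ℝ} (hR : 0 < R) (hq : 0 < q)
    (hf : AnalyticOnNhd ℂ f disc) (hc : closedBall c R ⊆ disc) :
    circleAverage (fun z => ‖f z‖ ^ q) 0 ‖c‖ ≤
      circleAverage (fun w => circleAverage (fun z => ‖f z‖ ^ q) 0 ‖w‖) c R := by
  have hrot : ∀ α : ℝ, ∀ z ∈ disc, Complex.exp (α * Complex.I) * z ∈ disc := by
    intro α z hz
    simpa [disc, Complex.norm_exp_ofReal_mul_I] using hz
  set G : ℝ → ℝ → ℝ := fun α θ => ‖f (Complex.exp (α * Complex.I) * circleMap c R θ)‖ ^ q with hG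
  have hcont : Continuous (Function.uncurry G) := by
    refine Continuous.rpow_const ?_ fun _ => Or.inr hq.le
    refine Continuous.norm ?_
    refine hf.continuousOn.comp_continuous (by fun_prop) fun x => ?_
    exact hrot _ _ (hc (circleMap_mem_closedBall c hR.le _))
  have hcont' : Continuous fun α : ℝ => ‖f (Complex.exp (α * Complex.I) * c)‖ ^ q := by
    refine Continuous.rpow_const ?_ fun _ => Or.inr hq.le
    exact (hf.continuousOn.comp_continuous (by fun_prop)
        fun x => hrot _ _ (hc (mem_closedBall_self hR.le))).norm
  have hcont'' : Continuous fun α : ℝ => ∫ θ in (0 : ℝ)..2 * π, G α θ :=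
    intervalIntegral.continuous_parametric_intervalIntegral_of_continuous' hcont _ _
  -- Every rotation of f has the sub-mean value property; averaging over the angle α and
  -- interchanging the integrals gives the claim.
  have hsub : ∀ α : ℝ, ‖f (Complex.exp (α * Complex.I) * c)‖ ^ q ≤
      (2 * π)⁻¹ * ∫ θ in (0 : ℝ)..2 * π, G α θ := by
    intro α
    refine norm_rpow_le_circleAverage (f := fun z => f (Complex.exp (α * Complex.I) * z)) hR hq ?_
    intro z hz
    exact (hf _ (hrot α z (hc hz))).comp_of_eq (by fun_prop) rfl
  have hswap : ∫ θ in (0 : ℝ)..2 * π, ∫ α in (0 : ℝ)..2 * π, G α θ =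
      ∫ α in (0 : ℝ)..2 * π, ∫ θ in (0 : ℝ)..2 * π, G α θ := by
    refine (intervalIntegral_intervalIntegral_swap ?_).symm
    exact (hcont.continuousOn.integrableOn_compact
      (isCompact_uIcc.prod isCompact_uIcc)).mono_set
      (prod_mono (uIoc_subset_uIcc (a := 0) (b := 2 * π)) (uIoc_subset_uIcc (a := 0) (b := 2 * π)))
  simp only [circleAverage_norm_eq_rotation]
  rw [circleAverage_def]
  simp only [intervalIntegral.integral_const_mul, smul_eq_mul]
  refine mul_le_mul_of_nonneg_left ?_ (by positivity)
  rw [hswap, ← intervalIntegral.integral_const_mul]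
  exact intervalIntegral.integral_mono_on (by positivity) (hcont'.intervalIntegrable _ _)
    ((hcont''.const_mul _).intervalIntegrable _ _) fun α _ => hsub α

theorem continuousOn_mean {f : ℂ → ℂ} {q : ℝ} (hq : 0 < q) (hf : AnalyticOnNhd ℂ f disc) :
    ContinuousOn (circleAverage (fun z => ‖f z‖ ^ q) 0) (Ico 0 1) := by
  refine ContinuousOn.circleAverage ?_ fun r hr => hr.1
  refine ContinuousOn.rpow_const (hf.continuousOn.mono fun z hz => ?_).norm fun _ _ => Or.inr hq.le
  have : ‖z - 0‖ < 1 := hz.2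
  simpa [disc] using this

/-- Hardy's theorem: the integral means of an analytic function are nondecreasing. -/
theorem monotoneOn_mean {f : ℂ → ℂ} {q : ℝ} (hq : 0 < q) (hf : AnalyticOnNhd ℂ f disc) :
    MonotoneOn (circleAverage (fun z => ‖f z‖ ^ q) 0) (Ico 0 1) := by
  intro r hr s hs hrs
  set M := circleAverage (fun z => ‖f z‖ ^ q) 0 with hM
  have hcont : ContinuousOn (fun z : ℂ => M ‖z‖) (closedBall 0 s) :=
    (continuousOn_mean hq hf).comp continuous_norm.continuousOn fun z hz =>
      ⟨norm_nonneg z, (mem_closedBall_zero_iff.1 hz).trans_lt hs.2⟩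
  have hsubset : closedBall (0 : ℂ) s ⊆ disc := closedBall_subset_ball hs.2
  -- Maximum principle for M‖z‖ + ε‖z‖² on the closed disc of radius s: a maximum at an interior
  -- point c contradicts the strict sub-mean value inequality on the circle of radius s - ‖c‖. So it
  -- is attained on the boundary, and ε s² ≤ ε is the only loss.
  have key : ∀ ε : ℝ, 0 < ε → M r ≤ M s + ε := by
    intro ε hε
    obtain ⟨c, hc, hmax⟩ := (isCompact_closedBall (0 : ℂ) s).exists_isMaxOn
      ⟨0, mem_closedBall_self hs.1⟩
      (hcont.add (ContinuousOn.const_mul (b := ε) (by fun_prop :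
        ContinuousOn (fun z : ℂ => ‖z‖ ^ 2) (closedBall 0 s))))
    rw [mem_closedBall_zero_iff] at hc
    have hcs : ‖c‖ = s := by
      by_contra hne
      have hlt : ‖c‖ < s := lt_of_le_of_ne hc hne
      set R := s - ‖c‖ with hRdef
      have hR : 0 < R := sub_pos.2 hlt
      have hsub : closedBall c R ⊆ closedBall 0 s := by
        refine closedBall_subset_closedBall' ?_
        rw [dist_zero_right]
        linarith
      have hint : CircleIntegrable (fun z : ℂ => M ‖z‖) c R :=
        ContinuousOn.circleIntegrable hR.le (hcont.mono (sphere_subset_closedBall.trans hsub))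
      have hint' : CircleIntegrable (fun z : ℂ => ε * ‖z‖ ^ 2) c R :=
        ContinuousOn.circleIntegrable hR.le (by fun_prop)
      have h1 : circleAverage (fun z : ℂ => M ‖z‖ + ε * ‖z‖ ^ 2) c R ≤ M ‖c‖ + ε * ‖c‖ ^ 2 := by
        refine circleAverage_mono_on_of_le_circle (hint.add hint') fun z hz => ?_
        rw [abs_of_pos hR] at hz
        exact hmax (hsub (sphere_subset_closedBall hz))
      have h2 : circleAverage (fun z : ℂ => ε * ‖z‖ ^ 2) c R = ε * (‖c‖ ^ 2 + R ^ 2) := by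
        rw [← circleAverage_norm_sq]
        exact circleAverage_fun_smul (a := ε)
      rw [circleAverage_fun_add hint hint', h2] at h1
      have h3 := mean_le_circleAverage_mean hR hq hf (hsub.trans hsubset)
      have h4 : 0 < ε * R ^ 2 := by positivity
      simp only [hM] at h1
      linarith
    have hr' : (r : ℂ) ∈ closedBall (0 : ℂ) s := by
      rw [mem_closedBall_zero_iff, Complex.norm_real, norm_of_nonneg hr.1]
      exact hrs
    have h5 : M ‖(r : ℂ)‖ + ε * ‖(r : ℂ)‖ ^ 2 ≤ M ‖c‖ + ε * ‖c‖ ^ 2 := hmax hr'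
    rw [Complex.norm_real, norm_of_nonneg hr.1, hcs] at h5
    have h6 : s ^ 2 ≤ 1 := pow_le_one₀ hs.1 hs.2.le
    nlinarith [sq_nonneg r]
  exact le_of_forall_pos_le_add key

/-- The integral mean as a Bochner circle average. -/
theorem meanPow_eq_ofReal {f : ℂ → ℂ} {q r : ℝ} (hq : 0 < q) (hf : AnalyticOnNhd ℂ f disc)
    (hr : r ∈ Ico (0 : ℝ) 1) :
    meanPow q r f = ENNReal.ofReal (circleAverage (fun z => ‖f z‖ ^ q) 0 r) := by
  have hint : CircleIntegrable (fun z => ‖f z‖ ^ q) 0 r :=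
    circleIntegrable_norm_rpow hr.1 hq (hf.continuousOn.mono (closedBall_subset_ball hr.2))
  rw [circleAverage_def, smul_eq_mul, ENNReal.ofReal_mul (by positivity),
    ENNReal.ofReal_inv_of_pos (by positivity), meanPow,
    intervalIntegral.integral_of_le (by positivity),
    ofReal_integral_eq_lintegral_ofReal hint.1 (Eventually.of_forall fun _ => by positivity)]
  congr 2
  ext θ
  rw [← ENNReal.ofReal_rpow_of_nonneg (norm_nonneg _) hq.le, ofReal_norm]

/-- The sub-mean value property on circles about the origin. -/
theorem enorm_rpow_le_meanPow {f : ℂ → ℂ} {q r : ℝ} (hq : 0 < q) (hf : AnalyticOnNhd ℂ f disc)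
    (hr : r ∈ Ioo (0 : ℝ) 1) : ‖f 0‖ₑ ^ q ≤ meanPow q r f := by
  rw [meanPow_eq_ofReal hq hf ⟨hr.1.le, hr.2⟩, ← ofReal_norm,
    ENNReal.ofReal_rpow_of_nonneg (norm_nonneg _) hq.le]
  exact ENNReal.ofReal_le_ofReal (norm_rpow_le_circleAverage hr.1 hq
    fun z hz => hf z (closedBall_subset_ball hr.2 hz))

/-! ### Polar coordinates and the radial profile of the exponent. -/

theorem measurableSet_disc : MeasurableSet disc := measurableSet_ball

theorem mem_disc {z : ℂ} : z ∈ disc ↔ ‖z‖ < 1 := mem_ball_zero_iff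

theorem circleMap_mem_disc {r : ℝ} (hr : r ∈ Ioo (0 : ℝ) 1) (θ : ℝ) : circleMap 0 r θ ∈ disc := by
  rw [mem_disc, norm_circleMap_zero, abs_of_pos hr.1]
  exact hr.2

theorem setLIntegral_Ioo_pi_eq {G : ℝ → ℝ≥0∞} (hG : Function.Periodic G (2 * π)) :
    ∫⁻ θ in Ioo (-π) π, G θ = ∫⁻ θ in Ioc 0 (2 * π), G θ := by
  rw [setLIntegral_congr Ioo_ae_eq_Ioc]
  have h1 := isAddFundamentalDomain_Ioc two_pi_pos (-π)
  have h2 := isAddFundamentalDomain_Ioc two_pi_pos 0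
  rw [zero_add] at h2
  rw [show -π + 2 * π = π by ring] at h1
  refine h1.setLIntegral_eq h2 G ?_
  rintro ⟨_, n, rfl⟩ x
  change G (n • (2 * π) + x) = G x
  rw [add_comm]
  exact hG.zsmul n x

/-- Integration in polar coordinates over the disc. -/
theorem setLIntegral_disc_eq_polar {F : ℂ → ℝ≥0∞} (hF : Measurable (disc.indicator F)) :
    ∫⁻ z in disc, F z = ∫⁻ r in Ioo (0 : ℝ) 1,
      (∫⁻ θ in Ioc 0 (2 * π), F (circleMap 0 r θ)) * ENNReal.ofReal r := by
  have hsymm : ∀ r θ : ℝ, Complex.polarCoord.symm (r, θ) = circleMap 0 r θ := by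
    intro r θ
    simp [circleMap, Complex.exp_mul_I]
  set G := disc.indicator F with hG
  have hmeas : Measurable fun x : ℝ × ℝ => ENNReal.ofReal x.1 * G (circleMap 0 x.1 x.2) :=
    (by fun_prop : Measurable fun x : ℝ × ℝ => ENNReal.ofReal x.1).mul
      (hF.comp circleMap.continuous.measurable)
  rw [← lintegral_indicator measurableSet_disc, ← Complex.lintegral_comp_polarCoord_symm,
    polarCoord_target, Measure.volume_eq_prod, ← Measure.prod_restrict]
  simp only [smul_eq_mul]
  have h1 : ∀ x : ℝ × ℝ, ENNReal.ofReal x.1 * disc.indicator F (Complex.polarCoord.symm x) =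
      ENNReal.ofReal x.1 * G (circleMap 0 x.1 x.2) := fun x => by rw [← hsymm, hG]
  simp only [h1]
  rw [lintegral_prod _ hmeas.aemeasurable]
  have h2 : ∀ r ∈ Ioi (0 : ℝ), ∫⁻ θ in Ioo (-π) π, ENNReal.ofReal r * G (circleMap 0 r θ) =
      (Ioo (0 : ℝ) 1).indicator (fun r =>
        (∫⁻ θ in Ioc 0 (2 * π), F (circleMap 0 r θ)) * ENNReal.ofReal r) r := by
    intro r hr
    have hm : Measurable fun θ => G (circleMap 0 r θ) :=
      hF.comp (continuous_circleMap 0 r).measurable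
    rw [lintegral_const_mul _ hm, mul_comm,
      setLIntegral_Ioo_pi_eq (fun θ => by simp only [periodic_circleMap 0 r θ])]
    by_cases h : r < 1
    · rw [indicator_of_mem (show r ∈ Ioo 0 1 from ⟨hr, h⟩)]
      congr 2
      ext θ
      rw [hG, indicator_of_mem (circleMap_mem_disc ⟨hr, h⟩ θ)]
    · rw [indicator_of_notMem (fun h' => h h'.2)]
      have : ∀ θ, G (circleMap 0 r θ) = 0 := fun θ => by
        rw [hG, indicator_of_notMem]
        rw [mem_disc, norm_circleMap_zero, abs_of_pos hr]
        exact h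
      simp [this]
  rw [setLIntegral_congr_fun measurableSet_Ioi h2, lintegral_indicator measurableSet_Ioo,
    Measure.restrict_restrict measurableSet_Ioo, inter_eq_left.2 fun r hr => hr.1]

theorem lintegral_dA_eq_polar {F : ℂ → ℝ≥0∞} (hF : Measurable (disc.indicator F)) :
    ∫⁻ z, F z ∂dA = 2 * ∫⁻ r in Ioo (0 : ℝ) 1, ((ENNReal.ofReal (2 * π))⁻¹ *
      ∫⁻ θ in Ioc 0 (2 * π), F (circleMap 0 r θ)) * ENNReal.ofReal r := by
  have hπ : ENNReal.ofReal π ≠ 0 := by simp [pi_pos]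
  rw [dA, lintegral_smul_measure, setLIntegral_disc_eq_polar hF]
  simp only [mul_assoc]
  rw [lintegral_const_mul' _ _ (by simp [pi_pos]), smul_eq_mul, ← mul_assoc]
  congr 1
  rw [ENNReal.ofReal_mul (by norm_num), ENNReal.mul_inv (by simp) (by simp), ← mul_assoc]
  rw [ENNReal.ofReal_ofNat, ENNReal.mul_inv_cancel (by simp) (by simp), one_mul]

theorem setLIntegral_ofReal_id : ∫⁻ r in Ioo (0 : ℝ) 1, ENNReal.ofReal r = 2⁻¹ := by
  rw [setLIntegral_congr Ioo_ae_eq_Ioc,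
    ← ofReal_integral_eq_lintegral_ofReal (f := fun r : ℝ => r)
      (continuous_id.intervalIntegrable 0 1).1,
    ← intervalIntegral.integral_of_le zero_le_one]
  · rw [integral_id]
    rw [show ((1 : ℝ) ^ 2 - 0 ^ 2) / 2 = 2⁻¹ by norm_num, ENNReal.ofReal_inv_of_pos (by norm_num)]
    simp
  · filter_upwards [ae_restrict_mem measurableSet_Ioc] with r hr using hr.1.le

theorem dA_univ : dA univ = 1 := by
  rw [dA, Measure.smul_apply, Measure.restrict_apply_univ, disc, Complex.volume_ball, smul_eq_mul,
    ENNReal.ofReal_one, one_pow, one_mul]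
  have : (NNReal.pi : ℝ≥0∞) = ENNReal.ofReal π := by
    rw [← NNReal.coe_real_pi, ENNReal.ofReal_coe_nnreal]
  rw [this]
  exact ENNReal.inv_mul_cancel (by simp [pi_pos]) (by simp)

instance : IsProbabilityMeasure dA := ⟨dA_univ⟩

theorem ae_dA_mem_disc : ∀ᵐ z ∂dA, z ∈ disc :=
  Measure.ae_smul_measure (ae_restrict_mem measurableSet_disc) _

/-- Tonelli in polar coordinates, the density r being nonzero on (0,1). It moves null sets between
the disc and its radii. -/
theorem ae_dA_mem_iff {S : Set ℂ} (hS : MeasurableSet S) :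
    (∀ᵐ z ∂dA, z ∈ S) ↔ ∀ᵐ r ∂volume.restrict (Ioo (0 : ℝ) 1),
      ∀ᵐ θ ∂volume.restrict (Ioc 0 (2 * π)), circleMap 0 r θ ∈ S := by
  have hF : Measurable (Sᶜ.indicator (1 : ℂ → ℝ≥0∞)) := measurable_one.indicator hS.compl
  have hF1 : ∀ r : ℝ, Measurable fun θ => Sᶜ.indicator (1 : ℂ → ℝ≥0∞) (circleMap 0 r θ) :=
    fun r => hF.comp (continuous_circleMap 0 r).measurable
  have hF2 : Measurable fun x : ℝ × ℝ => Sᶜ.indicator (1 : ℂ → ℝ≥0∞) (circleMap 0 x.1 x.2) :=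
    hF.comp circleMap.continuous.measurable
  have h1 : (∀ᵐ z ∂dA, z ∈ S) ↔ ∫⁻ z, Sᶜ.indicator (1 : ℂ → ℝ≥0∞) z ∂dA = 0 := by
    rw [lintegral_indicator_one hS.compl]; rfl
  rw [h1, lintegral_dA_eq_polar (hF.indicator measurableSet_disc), mul_eq_zero]
  simp only [OfNat.ofNat_ne_zero, false_or]
  have hF3 : Measurable fun r : ℝ => ((ENNReal.ofReal (2 * π))⁻¹ *
      ∫⁻ θ in Ioc 0 (2 * π), Sᶜ.indicator (1 : ℂ → ℝ≥0∞) (circleMap 0 r θ)) * ENNReal.ofReal r :=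
    (Measurable.const_mul (hF2.lintegral_prod_right') _).mul ENNReal.measurable_ofReal
  rw [lintegral_eq_zero_iff hF3]
  refine ⟨fun h => ?_, fun h => ?_⟩
  · filter_upwards [h, ae_restrict_mem measurableSet_Ioo] with r hr hr'
    have h0 : ENNReal.ofReal r ≠ 0 := by simp [hr'.1]
    simp only [Pi.zero_apply, mul_eq_zero, h0, or_false, ENNReal.inv_eq_zero, ENNReal.ofReal_ne_top,
      false_or] at hr
    rw [lintegral_eq_zero_iff (hF1 r)] at hr
    filter_upwards [hr] with θ hθ
    by_contra hc
    simp [hc] at hθ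
  · filter_upwards [h] with r hr
    have : ∫⁻ θ in Ioc 0 (2 * π), Sᶜ.indicator (1 : ℂ → ℝ≥0∞) (circleMap 0 r θ) = 0 := by
      rw [lintegral_eq_zero_iff (hF1 r)]
      filter_upwards [hr] with θ hθ
      simp [hθ]
    simp [this]

/-- A radial variable exponent is, up to null sets, a bounded measurable function of the modulus. -/
theorem IsVariableExponent.exists_profile {p : ℂ → ℝ} {q : ℝ} (hp : IsVariableExponent p)
    (hrad : IsRadial p) (hqp : ∀ᵐ z ∂dA, q ≤ p z) :
    ∃ P : ℝ → ℝ, ∃ B : ℝ, Measurable P ∧ (∀ r, q ≤ P r) ∧ (∀ r, P r ≤ B) ∧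
      (∀ᵐ r : ℝ ∂volume.restrict (Ioo (0 : ℝ) 1), p (r : ℂ) = P r) ∧ ∀ᵐ z ∂dA, p z = P ‖z‖ := by
  obtain ⟨B, hB, -⟩ := EReal.lt_iff_exists_real_btwn.1 hp.essSup_lt_top
  have hpB : ∀ᵐ z ∂dA, p z ≤ B := by
    filter_upwards [ae_le_essSup (f := fun z => (p z : EReal)) (μ := dA)] with z hz
    exact_mod_cast hz.trans hB.le
  obtain ⟨p', hp'm, hp'⟩ := hp.aemeasurable
  obtain ⟨S, hS, hSm, hSp⟩ := (hp'.and (hqp.and hpB)).exists_measurable_mem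
  have hSae := (ae_dA_mem_iff hSm).1 hS
  have hSm2 : MeasurableSet {x : ℝ × ℝ | circleMap 0 x.1 x.2 ∈ S} :=
    circleMap.continuous.measurable hSm
  -- Exchanging the two quantifiers yields a ray along which the measurable representative `p'`
  -- agrees with p at almost every radius; its restriction to that ray is the profile.
  have hswap := (Measure.ae_ae_comm (μ := volume.restrict (Ioo (0 : ℝ) 1))
    (ν := volume.restrict (Ioc 0 (2 * π))) hSm2).1 hSae
  have : NeZero (volume.restrict (Ioc 0 (2 * π))) := ⟨by simp [Measure.restrict_eq_zero, pi_pos]⟩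
  obtain ⟨θ, hθ⟩ := hswap.exists
  have hpr : ∀ r ∈ Ioo (0 : ℝ) 1, ∀ α, p (circleMap 0 r α) = p (r : ℂ) := fun r hr α => by
    rw [hrad _ (circleMap_mem_disc hr α), norm_circleMap_zero, abs_of_pos hr.1]
  -- The truncation changes P only on a null set and makes both bounds hold everywhere.
  set P : ℝ → ℝ := fun r => max q (min B (p' (circleMap 0 r θ))) with hP
  have hPm : Measurable P :=
    measurable_const.max (measurable_const.min
      (hp'm.comp (by fun_prop [circleMap] : Measurable fun r : ℝ => circleMap 0 r θ)))
  have hPp : ∀ᵐ r : ℝ ∂volume.restrict (Ioo (0 : ℝ) 1), p (r : ℂ) = P r := by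
    filter_upwards [hθ, ae_restrict_mem measurableSet_Ioo] with r hr hr'
    obtain ⟨h1, h2, h3⟩ := hSp _ hr
    rw [hpr r hr'] at h1 h2 h3
    simp only [hP]
    rw [← h1, min_eq_right h3, max_eq_right h2]
  refine ⟨P, max q B, hPm, fun r => le_max_left _ _, fun r => max_le_max le_rfl (min_le_left _ _),
    hPp, ?_⟩
  have hS2 : MeasurableSet {z : ℂ | p' z = P ‖z‖} :=
    measurableSet_eq_fun hp'm (hPm.comp measurable_norm)
  have hae2 : ∀ᵐ z ∂dA, z ∈ {z : ℂ | p' z = P ‖z‖} := by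
    rw [ae_dA_mem_iff hS2]
    filter_upwards [hSae, hPp, ae_restrict_mem measurableSet_Ioo] with r hr hr1 hr2
    filter_upwards [hr] with α hα
    rw [norm_circleMap_zero, abs_of_pos hr2.1, ← hr1, ← hpr r hr2 α, (hSp _ hα).1]
  filter_upwards [hp', hae2] with z h1 h2
  rw [h1]
  exact h2

/-! ### Modulars through integral means, and point evaluations. -/

theorem measurable_indicator_of_continuousOn {f : ℂ → ℂ} (hf : ContinuousOn f disc) :
    Measurable (disc.indicator f) := by
  classical
  rw [← piecewise_eq_indicator]
  exact hf.measurable_piecewise continuousOn_const measurableSet_disc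

theorem measurable_indicator_enorm_rpow {f : ℂ → ℂ} {P : ℝ → ℝ} (hP : Measurable P)
    (hf : ContinuousOn f disc) : Measurable (disc.indicator fun z => ‖f z‖ₑ ^ P ‖z‖) := by
  have h : (disc.indicator fun z => ‖f z‖ₑ ^ P ‖z‖) =
      disc.indicator fun z => ‖disc.indicator f z‖ₑ ^ P ‖z‖ := by
    refine indicator_congr fun z hz => ?_
    rw [indicator_of_mem hz]
  rw [h]
  exact ((measurable_indicator_of_continuousOn hf).enorm.pow (hP.comp measurable_norm)).indicator
    measurableSet_disc

/-- The modular of a radial exponent in terms of integral means. -/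
theorem modular_radial_eq {f : ℂ → ℂ} {P : ℝ → ℝ} (hP : Measurable P) (hf : ContinuousOn f disc) :
    modular (fun z => P ‖z‖) f =
      2 * ∫⁻ r in Ioo (0 : ℝ) 1, meanPow (P r) r f * ENNReal.ofReal r := by
  rw [modular, lintegral_dA_eq_polar (measurable_indicator_enorm_rpow hP hf)]
  congr 1
  refine setLIntegral_congr_fun measurableSet_Ioo fun r hr => ?_
  simp only [meanPow, norm_circleMap_zero, abs_of_pos hr.1]

theorem modular_const_eq {f : ℂ → ℂ} {q : ℝ} (hf : ContinuousOn f disc) :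
    modular (fun _ => q) f =
      2 * ∫⁻ r in Ioo (0 : ℝ) 1, meanPow q r f * ENNReal.ofReal r :=
  modular_radial_eq (P := fun _ => q) measurable_const hf

theorem lintegral_comp_add_mul {H : ℂ → ℝ≥0∞} (hH : Measurable H) (c : ℂ) {R : ℝ} (hR : 0 < R) :
    ∫⁻ z, H (c + R * z) = ENNReal.ofReal (R ^ 2)⁻¹ * ∫⁻ z, H z := by
  have h1 : ∫⁻ z : ℂ, H (c + R • z) = ∫⁻ z, H (c + z) ∂(Measure.map (R • ·) volume) := by
    rw [lintegral_map (f := fun z => H (c + z)) (hH.comp (measurable_const_add c))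
      (measurable_const_smul R)]
  rw [show (∫⁻ z : ℂ, H (c + R * z)) = ∫⁻ z : ℂ, H (c + R • z) by simp only [Complex.real_smul],
    h1, Measure.map_addHaar_smul volume hR.ne', lintegral_smul_measure,
    lintegral_add_left_eq_self, Complex.finrank_real_complex, abs_of_pos (by positivity),
    smul_eq_mul]

/-- Point evaluations are bounded on the Bergman space. -/
theorem enorm_rpow_mul_le_modular {f : ℂ → ℂ} {q : ℝ} (hq : 0 < q) (hf : AnalyticOnNhd ℂ f disc)
    {c : ℂ} (hc : c ∈ disc) :
    ‖f c‖ₑ ^ q * ENNReal.ofReal ((1 - ‖c‖) ^ 2) ≤ modular (fun _ => q) f := by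
  set R : ℝ := 1 - ‖c‖ with hRdef
  have hR : 0 < R := sub_pos.2 (mem_disc.1 hc)
  have hmap : ∀ z ∈ disc, c + R * z ∈ disc := by
    intro z hz
    rw [mem_disc] at hz ⊢
    calc ‖c + R * z‖ ≤ ‖c‖ + R * ‖z‖ := by
          refine (norm_add_le _ _).trans_eq ?_
          rw [norm_mul, Complex.norm_real, norm_of_nonneg hR.le]
      _ < ‖c‖ + R * 1 := by gcongr
      _ = 1 := by rw [hRdef]; ring
  -- The largest disc about c inside the unit disc is rescaled to the unit disc; the area factor R²
  -- is the growth factor (1-‖c‖)².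
  set g : ℂ → ℂ := fun z => f (c + R * z) with hg
  have hga : AnalyticOnNhd ℂ g disc := fun z hz =>
    (hf _ (hmap z hz)).comp_of_eq (by fun_prop) rfl
  have h1 : ‖f c‖ₑ ^ q ≤ modular (fun _ => q) g := by
    rw [modular_const_eq hga.continuousOn]
    calc ‖f c‖ₑ ^ q = 2 * ∫⁻ r in Ioo (0 : ℝ) 1, ‖g 0‖ₑ ^ q * ENNReal.ofReal r := by
          rw [lintegral_const_mul _ ENNReal.measurable_ofReal, setLIntegral_ofReal_id, mul_comm,
            mul_assoc, ENNReal.inv_mul_cancel (by simp) (by simp), mul_one]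
          simp [hg]
      _ ≤ _ := by
          gcongr 2 * ?_
          refine setLIntegral_mono' measurableSet_Ioo fun r hr => ?_
          gcongr
          exact enorm_rpow_le_meanPow hq hga hr
  have hH : Measurable (disc.indicator fun z => ‖f z‖ₑ ^ q) :=
    measurable_indicator_enorm_rpow (P := fun _ => q) measurable_const hf.continuousOn
  have h2 : modular (fun _ => q) g ≤ ENNReal.ofReal (R ^ 2)⁻¹ * modular (fun _ => q) f := by
    simp only [modular, dA, lintegral_smul_measure, smul_eq_mul]
    rw [mul_left_comm]
    gcongr
    rw [← lintegral_indicator measurableSet_disc, ← lintegral_indicator measurableSet_disc,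
      ← lintegral_comp_add_mul hH c hR]
    refine lintegral_mono fun z => ?_
    by_cases hz : z ∈ disc
    · rw [indicator_of_mem hz, indicator_of_mem (hmap z hz)]
    · rw [indicator_of_notMem hz]
      exact zero_le
  calc ‖f c‖ₑ ^ q * ENNReal.ofReal (R ^ 2)
      ≤ (ENNReal.ofReal (R ^ 2)⁻¹ * modular (fun _ => q) f) * ENNReal.ofReal (R ^ 2) := by
        gcongr
        exact h1.trans h2
    _ = modular (fun _ => q) f := by
        rw [mul_right_comm, ← ENNReal.ofReal_mul (by positivity), inv_mul_cancel₀ (by positivity),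
          ENNReal.ofReal_one, one_mul]

/-! ### Averages of a weight near 1 and nondecreasing functions. -/

/-- The shells at the scales x/2^k cover the interval and their lengths add up to x, so the constant
is unchanged. -/
theorem setLIntegral_Ico_le_of_dyadic {W : ℝ → ℝ≥0∞} {K : ℝ≥0}
    (h : ∀ x : ℝ, 0 < x → x ≤ 1 →
      ENNReal.ofReal (2 / x) * ∫⁻ r in Icc (1 - x) (1 - x / 2), W r ≤ K)
    {x : ℝ} (hx : 0 < x) (hx1 : x ≤ 1) :
    ENNReal.ofReal (1 / x) * ∫⁻ r in Ico (1 - x) 1, W r ≤ K := by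
  set y : ℕ → ℝ := fun k => x * (1 / 2) ^ k with hy
  have hy0 : ∀ k, 0 < y k := fun k => by positivity
  have hy1 : ∀ k, y k ≤ 1 := fun k =>
    mul_le_one₀ hx1 (by positivity) (pow_le_one₀ (by norm_num) (by norm_num))
  have hsub : Ico (1 - x) 1 ⊆ ⋃ k, Icc (1 - y k) (1 - y k / 2) := by
    intro r hr
    obtain ⟨n, h1, h2⟩ := exists_nat_pow_near_of_lt_one (x := (1 - r) / x) (y := 1 / 2)
      (div_pos (sub_pos.2 hr.2) hx) (by rw [div_le_one hx]; linarith [hr.1]) (by norm_num)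
      (by norm_num)
    rw [lt_div_iff₀ hx, pow_succ] at h1
    rw [div_le_iff₀ hx] at h2
    refine mem_iUnion.2 ⟨n, ?_, ?_⟩ <;> simp only [hy] <;> nlinarith
  have hshell : ∀ k, ∫⁻ r in Icc (1 - y k) (1 - y k / 2), W r ≤ K * ENNReal.ofReal (y k / 2) := by
    intro k
    have h1 : ENNReal.ofReal (y k / 2) * ENNReal.ofReal (2 / y k) = 1 := by
      rw [← ENNReal.ofReal_mul (by have := hy0 k; positivity)]
      have := (hy0 k).ne'
      field_simp
      simp
    calc ∫⁻ r in Icc (1 - y k) (1 - y k / 2), W r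
        = ENNReal.ofReal (y k / 2) * (ENNReal.ofReal (2 / y k) *
            ∫⁻ r in Icc (1 - y k) (1 - y k / 2), W r) := by rw [← mul_assoc, h1, one_mul]
      _ ≤ ENNReal.ofReal (y k / 2) * K := by gcongr; exact h _ (hy0 k) (hy1 k)
      _ = _ := mul_comm _ _
  have hsum : ∑' k, ENNReal.ofReal (y k / 2) = ENNReal.ofReal x := by
    have h1 : HasSum (fun k => y k / 2) x := by
      have := (hasSum_geometric_two.mul_left x).div_const 2
      rwa [mul_div_cancel_right₀ x two_ne_zero] at this
    rw [← ENNReal.ofReal_tsum_of_nonneg (fun k => by have := hy0 k; positivity) h1.summable,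
      h1.tsum_eq]
  calc ENNReal.ofReal (1 / x) * ∫⁻ r in Ico (1 - x) 1, W r
      ≤ ENNReal.ofReal (1 / x) * (K * ENNReal.ofReal x) := by
        gcongr
        calc ∫⁻ r in Ico (1 - x) 1, W r
            ≤ ∑' k, ∫⁻ r in Icc (1 - y k) (1 - y k / 2), W r :=
              (lintegral_mono_set hsub).trans (lintegral_iUnion_le _ _)
          _ ≤ ∑' k, K * ENNReal.ofReal (y k / 2) := ENNReal.tsum_le_tsum hshell
          _ = K * ENNReal.ofReal x := by rw [ENNReal.tsum_mul_left, hsum]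
    _ = K := by
        rw [mul_left_comm, ← ENNReal.ofReal_mul (by positivity), one_div, inv_mul_cancel₀ hx.ne',
          ENNReal.ofReal_one, mul_one]

/-- A weight whose averages over `[1 - x, 1)` are bounded is bounded on nondecreasing functions. -/
theorem lintegral_mul_monotone_le {W : ℝ → ℝ≥0∞} (hW : Measurable W) {K : ℝ≥0}
    (h : ∀ x : ℝ, 0 < x → x ≤ 1 → ENNReal.ofReal (1 / x) * ∫⁻ r in Ico (1 - x) 1, W r ≤ K)
    {g : ℝ → ℝ} (hg0 : ∀ r ∈ Ioo (0 : ℝ) 1, 0 ≤ g r) (hg : MonotoneOn g (Ioo (0 : ℝ) 1)) :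
    ∫⁻ r in Ioo (0 : ℝ) 1, W r * ENNReal.ofReal (g r) ≤
      K * ∫⁻ r in Ioo (0 : ℝ) 1, ENNReal.ofReal (g r) := by
  set ν : Measure ℝ := volume.restrict (Ioo (0 : ℝ) 1) with hν
  have hgm : AEMeasurable g ν := aemeasurable_restrict_of_monotoneOn measurableSet_Ioo hg
  have hac : ν.withDensity W ≪ ν := withDensity_absolutelyContinuous _ _
  have hpos : 0 ≤ᵐ[ν] g := by
    filter_upwards [ae_restrict_mem measurableSet_Ioo] with r hr using hg0 r hr
  have h1 : ∫⁻ r, W r * ENNReal.ofReal (g r) ∂ν =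
      ∫⁻ r, ENNReal.ofReal (g r) ∂(ν.withDensity W) :=
    (lintegral_withDensity_eq_lintegral_mul₀ hW.aemeasurable hgm.ennreal_ofReal).symm
  -- Layer cake on both sides: only the measures of each superlevel set A need comparing. As g is
  -- nondecreasing, A lies between `Ioo (1 - x) 1` and `Ico (1 - x) 1`, where 1 - x is its infimum.
  rw [h1, lintegral_eq_lintegral_meas_lt _ (hac.ae_le hpos) (hgm.mono_ac hac),
    lintegral_eq_lintegral_meas_lt _ hpos hgm, ← lintegral_const_mul' _ _ ENNReal.coe_ne_top]
  refine lintegral_mono fun t => ?_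
  rw [withDensity_apply', hν, Measure.restrict_restrict' measurableSet_Ioo,
    Measure.restrict_apply' measurableSet_Ioo]
  set A : Set ℝ := {r | t < g r} ∩ Ioo 0 1 with hA
  rcases A.eq_empty_or_nonempty with hemp | hne
  · simp [hemp]
  have hbdd : BddBelow A := ⟨0, fun r hr => hr.2.1.le⟩
  set x : ℝ := 1 - sInf A with hx
  obtain ⟨a, ha⟩ := hne
  have hx0 : 0 < x := sub_pos.2 ((csInf_le hbdd ha).trans_lt ha.2.2)
  have hx1 : x ≤ 1 := by
    have : 0 ≤ sInf A := le_csInf ⟨a, ha⟩ fun r hr => hr.2.1.le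
    linarith
  have hsub : A ⊆ Ico (1 - x) 1 := fun r hr => ⟨by rw [hx]; linarith [csInf_le hbdd hr], hr.2.2⟩
  have hsup : Ioo (1 - x) 1 ⊆ A := by
    intro r hr
    obtain ⟨b, hb, hbr⟩ := exists_lt_of_csInf_lt ⟨a, ha⟩ (by rw [hx] at hr; linarith [hr.1] :
      sInf A < r)
    have hr' : r ∈ Ioo (0 : ℝ) 1 := ⟨hb.2.1.trans hbr, hr.2⟩
    exact ⟨lt_of_lt_of_le hb.1 (hg hb.2 hr' hbr.le), hr'⟩
  calc ∫⁻ r in A, W r ≤ ∫⁻ r in Ico (1 - x) 1, W r := lintegral_mono_set hsub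
    _ = ENNReal.ofReal x * (ENNReal.ofReal (1 / x) * ∫⁻ r in Ico (1 - x) 1, W r) := by
        rw [← mul_assoc, ← ENNReal.ofReal_mul hx0.le, mul_one_div_cancel hx0.ne',
          ENNReal.ofReal_one, one_mul]
    _ ≤ ENNReal.ofReal x * K := by gcongr; exact h x hx0 hx1
    _ = K * volume (Ioo (1 - x) 1) := by rw [Real.volume_Ioo, mul_comm]; congr 3; ring
    _ ≤ K * volume A := by gcongr

/-- The test function is the indicator of the half-line `Ioi (1 - x)`, left continuous because the
half-line is open. -/
theorem setLIntegral_Ico_le_of_monotone {W : ℝ → ℝ≥0∞} {K : ℝ≥0}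
    (h : ∀ g : ℝ → ℝ, (∀ r ∈ Ico (0 : ℝ) 1, 0 ≤ g r) → MonotoneOn g (Ico (0 : ℝ) 1) →
      (∀ r ∈ Ioo (0 : ℝ) 1, ContinuousWithinAt g (Iic r) r) →
      ∫⁻ r in Ioo (0 : ℝ) 1, W r * ENNReal.ofReal (g r) ≤
        K * ∫⁻ r in Ioo (0 : ℝ) 1, ENNReal.ofReal (g r))
    {x : ℝ} (hx : 0 < x) (hx1 : x ≤ 1) :
    ENNReal.ofReal (1 / x) * ∫⁻ r in Ico (1 - x) 1, W r ≤ K := by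
  have hind : ∀ V : ℝ → ℝ≥0∞, ∫⁻ r in Ioo (0 : ℝ) 1,
      V r * ENNReal.ofReal ((Ioi (1 - x)).indicator (1 : ℝ → ℝ) r) = ∫⁻ r in Ico (1 - x) 1, V r := by
    intro V
    have h1 : ∀ r, V r * ENNReal.ofReal ((Ioi (1 - x)).indicator (1 : ℝ → ℝ) r) =
        (Ioi (1 - x)).indicator V r := by
      intro r
      by_cases hr : r ∈ Ioi (1 - x) <;> simp [hr]
    simp only [h1]
    rw [lintegral_indicator measurableSet_Ioi, Measure.restrict_restrict measurableSet_Ioi,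
      Ioi_inter_Ioo, max_eq_left (by linarith), setLIntegral_congr Ioo_ae_eq_Ico]
  have h2 := h ((Ioi (1 - x)).indicator 1) (fun r _ => indicator_nonneg (by simp) r) ?_ ?_
  · have h3 := hind fun _ => 1
    simp only [one_mul] at h3
    rw [hind, h3, setLIntegral_one, Real.volume_Ico] at h2
    calc ENNReal.ofReal (1 / x) * ∫⁻ r in Ico (1 - x) 1, W r
        ≤ ENNReal.ofReal (1 / x) * (K * ENNReal.ofReal (1 - (1 - x))) := by gcongr
      _ = K := by
        rw [sub_sub_cancel, mul_left_comm, ← ENNReal.ofReal_mul (by positivity), one_div,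
          inv_mul_cancel₀ hx.ne', ENNReal.ofReal_one, mul_one]
  · intro a _ b _ hab
    by_cases ha : a ∈ Ioi (1 - x)
    · have hb : b ∈ Ioi (1 - x) := lt_of_lt_of_le ha hab
      rw [indicator_of_mem ha, indicator_of_mem hb]
      exact le_rfl
    · rw [indicator_of_notMem ha]
      exact indicator_nonneg (by simp) b
  · intro r _
    by_cases hr : r ∈ Ioi (1 - x)
    · have : (Ioi (1 - x)).indicator (1 : ℝ → ℝ) =ᶠ[nhds r] fun _ => 1 := by
        filter_upwards [Ioi_mem_nhds hr] with s hs
        rw [indicator_of_mem hs, Pi.one_apply]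
      exact (continuousAt_const.congr this.symm).continuousWithinAt
    · refine (continuousWithinAt_const (b := (0 : ℝ))).congr (fun s hs => ?_) ?_
      · exact indicator_of_notMem (fun h' => hr (lt_of_lt_of_le h' hs)) _
      · exact indicator_of_notMem hr _

theorem lintegral_mul_meanPow_le {W : ℝ → ℝ≥0∞} (hW : Measurable W) {K : ℝ≥0}
    (h : ∀ x : ℝ, 0 < x → x ≤ 1 → ENNReal.ofReal (1 / x) * ∫⁻ r in Ico (1 - x) 1, W r ≤ K)
    {f : ℂ → ℂ} {q : ℝ} (hq : 0 < q) (hf : AnalyticOnNhd ℂ f disc) :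
    ∫⁻ r in Ioo (0 : ℝ) 1, W r * meanPow q r f * ENNReal.ofReal r ≤
      K * ∫⁻ r in Ioo (0 : ℝ) 1, meanPow q r f * ENNReal.ofReal r := by
  set M := circleAverage (fun z => ‖f z‖ ^ q) 0 with hM
  have hM0 : ∀ r, 0 ≤ M r := fun r => circleAverage_nonneg_of_nonneg fun z _ => by positivity
  have heq : ∀ r ∈ Ioo (0 : ℝ) 1, meanPow q r f * ENNReal.ofReal r = ENNReal.ofReal (M r * r) := by
    intro r hr
    rw [meanPow_eq_ofReal hq hf ⟨hr.1.le, hr.2⟩, ENNReal.ofReal_mul (hM0 r)]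
  have hmono : MonotoneOn (fun r => M r * r) (Ioo (0 : ℝ) 1) := by
    intro r hr s hs hrs
    exact mul_le_mul (monotoneOn_mean hq hf ⟨hr.1.le, hr.2⟩ ⟨hs.1.le, hs.2⟩ hrs) hrs hr.1.le (hM0 s)
  rw [setLIntegral_congr_fun measurableSet_Ioo heq]
  have h2 : ∀ r ∈ Ioo (0 : ℝ) 1, W r * meanPow q r f * ENNReal.ofReal r =
      W r * ENNReal.ofReal (M r * r) := fun r hr => by rw [mul_assoc, heq r hr]
  rw [setLIntegral_congr_fun measurableSet_Ioo h2]
  exact lintegral_mul_monotone_le hW h (fun r hr => mul_nonneg (hM0 r) hr.1.le) hmono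

/-! ### Kernel estimates. -/

/-- From the identity |1 - w̄z|² - |z - w|² = (1-|w|²)(1-|z|²). -/
theorem norm_sub_le_norm_one_sub_conj_mul {w z : ℂ} (hw : w ∈ disc) (hz : z ∈ disc) :
    ‖z - w‖ ≤ ‖1 - (starRingEnd ℂ) w * z‖ := by
  rw [mem_disc] at hw hz
  rw [← sq_le_sq₀ (norm_nonneg _) (norm_nonneg _), ← Complex.normSq_eq_norm_sq,
    ← Complex.normSq_eq_norm_sq]
  have h1 : 0 ≤ 1 - Complex.normSq w := by
    rw [Complex.normSq_eq_norm_sq]; nlinarith [norm_nonneg w]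
  have h2 : 0 ≤ 1 - Complex.normSq z := by
    rw [Complex.normSq_eq_norm_sq]; nlinarith [norm_nonneg z]
  have h3 := mul_nonneg h1 h2
  simp only [Complex.normSq_apply, Complex.sub_re, Complex.sub_im, Complex.mul_re, Complex.mul_im,
    Complex.conj_re, Complex.conj_im, Complex.one_re, Complex.one_im] at h3 ⊢
  nlinarith

theorem one_sub_norm_le_norm_one_sub_conj_mul {w z : ℂ} (hz : z ∈ disc) :
    1 - ‖w‖ ≤ ‖1 - (starRingEnd ℂ) w * z‖ := by
  rw [mem_disc] at hz
  have h1 := norm_sub_norm_le (1 : ℂ) ((starRingEnd ℂ) w * z)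
  rw [norm_mul, RCLike.norm_conj, norm_one] at h1
  nlinarith [norm_nonneg w]

theorem one_sub_norm_sq_pos {w : ℂ} (hw : w ∈ disc) : 0 < 1 - ‖w‖ ^ 2 := by
  rw [mem_disc] at hw
  nlinarith [norm_nonneg w]

theorem norm_kernelFun {w : ℂ} (hw : w ∈ disc) (a q : ℝ) (z : ℂ) :
    ‖kernelFun w a q z‖ =
      (1 - ‖w‖ ^ 2) ^ (a - 2 / q) / ‖1 - (starRingEnd ℂ) w * z‖ ^ a := by
  rw [kernelFun, norm_div, Complex.norm_cpow_real, Complex.norm_real,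
    norm_of_nonneg (rpow_nonneg (one_sub_norm_sq_pos hw).le _)]

theorem analyticOnNhd_kernelFun {w : ℂ} (hw : w ∈ disc) (a q : ℝ) :
    AnalyticOnNhd ℂ (kernelFun w a q) disc := by
  intro z hz
  have hz' := mem_disc.1 hz
  have hw' := mem_disc.1 hw
  have hslit : 1 - (starRingEnd ℂ) w * z ∈ Complex.slitPlane := by
    left
    have h1 := Complex.re_le_norm ((starRingEnd ℂ) w * z)
    rw [norm_mul, RCLike.norm_conj] at h1
    rw [Complex.sub_re, Complex.one_re]
    nlinarith [norm_nonneg w, norm_nonneg z]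
  have h2 : AnalyticAt ℂ (fun z => (1 - (starRingEnd ℂ) w * z) ^ (a : ℂ)) z :=
    (analyticAt_const.sub (analyticAt_const.mul analyticAt_id)).cpow analyticAt_const hslit
  refine analyticAt_const.div h2 ?_
  rw [Complex.cpow_def_of_ne_zero (Complex.slitPlane_ne_zero hslit)]
  exact Complex.exp_ne_zero _

/-- The Forelli–Rudin estimate: the functions `kernelFun w a q` are bounded in `A^q`. -/
theorem exists_modular_kernelFun_le {q a : ℝ} (hq : 0 < q) (ha : 2 < a * q) :
    ∃ C : ℝ≥0, ∀ w ∈ disc, modular (fun _ => q) (kernelFun w a q) ≤ C := by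
  set s := a * q with hs
  set J : ℂ → ℝ≥0∞ := fun y => ENNReal.ofReal ((1 + ‖y‖) ^ (-s)) with hJ
  have hJm : Measurable J := by fun_prop
  have hJfin : ∫⁻ y, J y < ⊤ := finite_integral_one_add_norm (by simpa using ha)
  set C : ℝ≥0∞ := (ENNReal.ofReal π)⁻¹ * (ENNReal.ofReal (2 ^ (s - 2) * 2 ^ s) * ∫⁻ y, J y) with hC
  have hCfin : C ≠ ⊤ := by
    refine ENNReal.mul_ne_top ?_ (ENNReal.mul_ne_top ENNReal.ofReal_ne_top hJfin.ne)
    simp [pi_pos]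
  refine ⟨C.toNNReal, fun w hw => ?_⟩
  rw [ENNReal.coe_toNNReal hCfin]
  set δ := 1 - ‖w‖ with hδ
  have hδ0 : 0 < δ := sub_pos.2 (mem_disc.1 hw)
  -- In the variable y = (z-w)/δ the kernel is dominated by the fixed function `J`, integrable on
  -- the plane because s > 2. The factor δ^(-2) cancels the Jacobian, so the bound does not depend
  -- on w.
  have hpt : ∀ z ∈ disc, ‖kernelFun w a q z‖ₑ ^ q ≤
      ENNReal.ofReal (2 ^ (s - 2) * 2 ^ s * (δ ^ 2)⁻¹) * J (-(δ⁻¹ : ℝ) * w + (δ⁻¹ : ℝ) * z) := by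
    intro z hz
    rw [hJ, ← ENNReal.ofReal_mul (by positivity), ← ofReal_norm,
      ENNReal.ofReal_rpow_of_nonneg (norm_nonneg _) hq.le]
    refine ENNReal.ofReal_le_ofReal ?_
    have h0 := one_sub_norm_sq_pos hw
    have hden : (δ + ‖z - w‖) / 2 ≤ ‖1 - (starRingEnd ℂ) w * z‖ := by
      linarith [norm_sub_le_norm_one_sub_conj_mul hw hz,
        one_sub_norm_le_norm_one_sub_conj_mul (w := w) hz]
    have hden0 : 0 < (δ + ‖z - w‖) / 2 := by positivity
    have hnum : 1 - ‖w‖ ^ 2 ≤ 2 * δ := by rw [hδ]; nlinarith [sq_nonneg (1 - ‖w‖)]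
    have harg : ‖-((δ⁻¹ : ℝ) : ℂ) * w + ((δ⁻¹ : ℝ) : ℂ) * z‖ = ‖z - w‖ / δ := by
      rw [show -((δ⁻¹ : ℝ) : ℂ) * w + ((δ⁻¹ : ℝ) : ℂ) * z = ((δ⁻¹ : ℝ) : ℂ) * (z - w) by ring,
        norm_mul, Complex.norm_real, norm_of_nonneg (by positivity), inv_mul_eq_div]
    rw [norm_kernelFun hw, harg, div_rpow (by positivity) (by positivity), ← rpow_mul h0.le,
      ← rpow_mul (norm_nonneg _), sub_mul, div_mul_cancel₀ _ hq.ne', ← hs]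
    calc (1 - ‖w‖ ^ 2) ^ (s - 2) / ‖1 - (starRingEnd ℂ) w * z‖ ^ s
        ≤ (2 * δ) ^ (s - 2) / ((δ + ‖z - w‖) / 2) ^ s := by
          have hs0 : 0 ≤ s := by linarith
          have hs2 : 0 ≤ s - 2 := by linarith
          gcongr
      _ = 2 ^ (s - 2) * 2 ^ s * (δ ^ 2)⁻¹ * (1 + ‖z - w‖ / δ) ^ (-s) := by
          have h1 : (δ + ‖z - w‖) / 2 = δ * (1 + ‖z - w‖ / δ) / 2 := by field_simp
          rw [h1, div_rpow (by positivity) (by norm_num), mul_rpow hδ0.le (by positivity),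
            mul_rpow (by norm_num) hδ0.le, rpow_neg (by positivity), rpow_sub hδ0, rpow_two]
          have h2 : 0 < δ ^ s := by positivity
          have h3 : 0 < (1 + ‖z - w‖ / δ) ^ s := by positivity
          field_simp
  rw [modular, dA, lintegral_smul_measure, smul_eq_mul, hC]
  gcongr (ENNReal.ofReal π)⁻¹ * ?_
  calc ∫⁻ z in disc, ‖kernelFun w a q z‖ₑ ^ q
      ≤ ∫⁻ z in disc, ENNReal.ofReal (2 ^ (s - 2) * 2 ^ s * (δ ^ 2)⁻¹) *
          J (-(δ⁻¹ : ℝ) * w + (δ⁻¹ : ℝ) * z) := setLIntegral_mono' measurableSet_disc hpt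
    _ ≤ ∫⁻ z, ENNReal.ofReal (2 ^ (s - 2) * 2 ^ s * (δ ^ 2)⁻¹) *
          J (-(δ⁻¹ : ℝ) * w + (δ⁻¹ : ℝ) * z) := setLIntegral_le_lintegral _ _
    _ = ENNReal.ofReal (2 ^ (s - 2) * 2 ^ s) * ∫⁻ y, J y := by
        rw [lintegral_const_mul' _ _ ENNReal.ofReal_ne_top,
          lintegral_comp_add_mul hJm _ (inv_pos.2 hδ0), ← mul_assoc,
          ← ENNReal.ofReal_mul (by positivity)]
        congr 2
        field_simp

/-! ### Growth of functions in A^q and the weight. -/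

theorem weight_radial (P : ℝ → ℝ) (q : ℝ) {r : ℝ} (hr : 0 ≤ r) :
    weight (fun z => P ‖z‖) q r = ENNReal.ofReal (1 / (1 - r) ^ (2 * (P r - q) / q)) := by
  rw [weight, Complex.norm_real, norm_of_nonneg hr]

theorem measurable_weight_radial {P : ℝ → ℝ} (hP : Measurable P) (q : ℝ) :
    Measurable (weight (fun z => P ‖z‖) q) := by
  unfold weight
  have : Measurable fun r : ℝ => P ‖(r : ℂ)‖ :=
    hP.comp (measurable_norm.comp Complex.measurable_ofReal)
  fun_prop

/-- Growth of functions in `A^q` compares a variable exponent with the constant one. -/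
theorem enorm_rpow_le_weight_mul {f : ℂ → ℂ} {q B : ℝ} {P : ℝ → ℝ} {C : ℝ≥0} (hq : 0 < q)
    (hPq : ∀ r, q ≤ P r) (hPB : ∀ r, P r ≤ B) (hC : 1 ≤ C) (hf : AnalyticOnNhd ℂ f disc)
    (hfC : modular (fun _ => q) f ≤ C) {z : ℂ} (hz : z ∈ disc) :
    ‖f z‖ₑ ^ P ‖z‖ ≤
      (C : ℝ≥0∞) ^ ((B - q) / q) * weight (fun z => P ‖z‖) q ‖z‖ * ‖f z‖ₑ ^ q := by
  set r := ‖z‖ with hr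
  have hr1 : 0 < 1 - r := sub_pos.2 (mem_disc.1 hz)
  have he : 0 ≤ (P r - q) / q := div_nonneg (sub_nonneg.2 (hPq r)) hq.le
  have h1 : ‖f z‖ₑ ^ q ≤ C * ENNReal.ofReal ((1 - r) ^ 2)⁻¹ := by
    have := (enorm_rpow_mul_le_modular hq hf hz).trans hfC
    calc ‖f z‖ₑ ^ q = ‖f z‖ₑ ^ q * ENNReal.ofReal ((1 - ‖z‖) ^ 2) *
          ENNReal.ofReal ((1 - r) ^ 2)⁻¹ := by
          rw [mul_assoc, ← ENNReal.ofReal_mul (by positivity), ← hr,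
            mul_inv_cancel₀ (by positivity), ENNReal.ofReal_one, mul_one]
      _ ≤ _ := by gcongr
  have h2 : ‖f z‖ₑ ^ (P r - q) ≤
      (C : ℝ≥0∞) ^ ((B - q) / q) * weight (fun z => P ‖z‖) q r := by
    calc ‖f z‖ₑ ^ (P r - q) = (‖f z‖ₑ ^ q) ^ ((P r - q) / q) := by
          rw [← ENNReal.rpow_mul, mul_div_cancel₀ _ hq.ne']
      _ ≤ (C * ENNReal.ofReal ((1 - r) ^ 2)⁻¹) ^ ((P r - q) / q) := ENNReal.rpow_le_rpow h1 he
      _ = (C : ℝ≥0∞) ^ ((P r - q) / q) * weight (fun z => P ‖z‖) q r := by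
          rw [ENNReal.mul_rpow_of_nonneg _ _ he, weight_radial P q (norm_nonneg z),
            ENNReal.ofReal_rpow_of_nonneg (by positivity) he]
          congr 2
          rw [inv_rpow (by positivity), ← rpow_two, ← rpow_mul hr1.le, one_div, mul_div_assoc]
      _ ≤ _ := by
          gcongr
          · exact_mod_cast hC
          · exact hPB r
  calc ‖f z‖ₑ ^ P r = ‖f z‖ₑ ^ (P r - q) * ‖f z‖ₑ ^ q := by
        rw [← ENNReal.rpow_add_of_nonneg _ _ (sub_nonneg.2 (hPq r)) hq.le, sub_add_cancel]
    _ ≤ _ := by gcongr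

theorem lintegral_meanPow_le_lintegral_weight {f : ℂ → ℂ} {q B : ℝ} {P : ℝ → ℝ} {C : ℝ≥0}
    (hq : 0 < q) (hPq : ∀ r, q ≤ P r) (hPB : ∀ r, P r ≤ B) (hC : 1 ≤ C)
    (hf : AnalyticOnNhd ℂ f disc) (hfC : modular (fun _ => q) f ≤ C) :
    ∫⁻ r in Ioo (0 : ℝ) 1, meanPow (P r) r f * ENNReal.ofReal r ≤
      (C : ℝ≥0∞) ^ ((B - q) / q) * ∫⁻ r in Ioo (0 : ℝ) 1,
        weight (fun z => P ‖z‖) q r * meanPow q r f * ENNReal.ofReal r := by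
  have hqB : q ≤ B := (hPq 0).trans (hPB 0)
  have hCtop : (C : ℝ≥0∞) ^ ((B - q) / q) ≠ ⊤ :=
    ENNReal.rpow_ne_top_of_nonneg (div_nonneg (sub_nonneg.2 hqB) hq.le) ENNReal.coe_ne_top
  rw [← lintegral_const_mul' _ _ hCtop]
  refine setLIntegral_mono' measurableSet_Ioo fun r hr => ?_
  have hW : weight (fun z => P ‖z‖) q r ≠ ⊤ := ENNReal.ofReal_ne_top
  rw [← mul_assoc, ← mul_assoc]
  gcongr ?_ * _
  rw [meanPow, meanPow, mul_left_comm _ (ENNReal.ofReal (2 * π))⁻¹]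
  gcongr (ENNReal.ofReal (2 * π))⁻¹ * ?_
  rw [← lintegral_const_mul' _ _ (ENNReal.mul_ne_top hCtop hW)]
  refine lintegral_mono fun θ => ?_
  have := enorm_rpow_le_weight_mul hq hPq hPB hC hf hfC (circleMap_mem_disc hr θ)
  rwa [norm_circleMap_zero, abs_of_pos hr.1] at this

/-! ### Norms, scaling and inclusions. -/

theorem modular_const_div {f : ℂ → ℂ} {q t : ℝ} (hq : 0 < q) (ht : 0 < t) :
    modular (fun _ => q) (fun z => f z / (t : ℂ)) =
      modular (fun _ => q) f * ENNReal.ofReal (t ^ q)⁻¹ := by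
  rw [modular, modular, ← lintegral_mul_const' _ _ ENNReal.ofReal_ne_top]
  congr 1
  ext z
  rw [← ofReal_norm, ← ofReal_norm, ENNReal.ofReal_rpow_of_nonneg (norm_nonneg _) hq.le,
    ENNReal.ofReal_rpow_of_nonneg (norm_nonneg _) hq.le, ← ENNReal.ofReal_mul (by positivity),
    norm_div, Complex.norm_real, norm_of_nonneg ht.le, div_rpow (norm_nonneg _) ht.le,
    div_eq_mul_inv]

theorem luxNorm_const {f : ℂ → ℂ} {q : ℝ} (hq : 0 < q) (hf : modular (fun _ => q) f ≠ ⊤) :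
    luxNorm (fun _ => q) f = (modular (fun _ => q) f).toReal ^ (1 / q) := by
  have h : {t : ℝ | 0 < t ∧ modular (fun _ => q) (fun z => f z / (t : ℂ)) < 1} =
      Ioi ((modular (fun _ => q) f).toReal ^ (1 / q)) := by
    ext t
    have hn : 0 ≤ (modular (fun _ => q) f).toReal := ENNReal.toReal_nonneg
    have key : 0 < t → (modular (fun _ => q) (fun z => f z / (t : ℂ)) < 1 ↔
        (modular (fun _ => q) f).toReal ^ (1 / q) < t) := by
      intro ht
      rw [modular_const_div hq ht]
      nth_rw 1 [← ENNReal.ofReal_toReal hf]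
      rw [← ENNReal.ofReal_mul hn, ENNReal.ofReal_lt_one, ← div_eq_mul_inv,
        div_lt_one (by positivity), ← rpow_lt_rpow_iff (by positivity) ht.le hq,
        ← rpow_mul hn, one_div_mul_cancel hq.ne', rpow_one]
    exact ⟨fun h => (key h.1).1 h.2, fun h => by
      have ht : 0 < t := lt_of_le_of_lt (rpow_nonneg hn _) h
      exact ⟨ht, (key ht).2 h⟩⟩
  rw [luxNorm, h, csInf_Ioi]

theorem luxNorm_const_eq_one_iff {f : ℂ → ℂ} {q : ℝ} (hq : 0 < q)
    (hf : modular (fun _ => q) f ≠ ⊤) :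
    luxNorm (fun _ => q) f = 1 ↔ modular (fun _ => q) f = 1 := by
  have h := rpow_left_inj (ENNReal.toReal_nonneg (a := modular (fun _ => q) f)) zero_le_one
    (one_div_ne_zero hq.ne')
  rw [one_rpow] at h
  rw [luxNorm_const hq hf, h, ENNReal.toReal_eq_one_iff]

/-- A variable exponent is not homogeneous, but t^p ≤ max(1,t)^B since 0 ≤ p ≤ B; finiteness of the
modular thus survives scaling. -/
theorem modular_le_modular_div {f : ℂ → ℂ} {p : ℂ → ℝ} {B t : ℝ} (hp : ∀ z, 0 ≤ p z)
    (hpB : ∀ z, p z ≤ B) (ht : 0 < t) :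
    modular p f ≤ ENNReal.ofReal (max 1 t) ^ B * modular p (fun z => f z / (t : ℂ)) := by
  have hB : 0 ≤ B := (hp 0).trans (hpB 0)
  rw [modular, modular, ← lintegral_const_mul' _ _
    (ENNReal.rpow_ne_top_of_nonneg hB ENNReal.ofReal_ne_top)]
  refine lintegral_mono fun z => ?_
  have h1 : ‖f z‖ₑ = ENNReal.ofReal t * ‖f z / (t : ℂ)‖ₑ := by
    rw [← ofReal_norm, ← ofReal_norm, ← ENNReal.ofReal_mul ht.le, norm_div, Complex.norm_real,
      norm_of_nonneg ht.le, mul_div_cancel₀ _ ht.ne']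
  have h2 : (1 : ℝ≥0∞) ≤ ENNReal.ofReal (max 1 t) := by
    rw [← ENNReal.ofReal_one]; exact ENNReal.ofReal_le_ofReal (le_max_left _ _)
  simp only
  rw [h1, ENNReal.mul_rpow_of_nonneg _ _ (hp z)]
  gcongr ?_ * _
  calc ENNReal.ofReal t ^ p z ≤ ENNReal.ofReal (max 1 t) ^ p z :=
        ENNReal.rpow_le_rpow (ENNReal.ofReal_le_ofReal (le_max_right _ _)) (hp z)
    _ ≤ ENNReal.ofReal (max 1 t) ^ B := ENNReal.rpow_le_rpow_of_exponent_le h2 (hpB z)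

/-- Pointwise |f|^q ≤ 1 + |f|^p, and the total mass of `dA` is 1. -/
theorem bergman_radial_subset {q : ℝ} {p : ℂ → ℝ} (hq : 0 < q) (hpq : ∀ z, q ≤ p z) :
    bergman p ⊆ bergman (fun _ => q) := by
  rintro f ⟨hfa, hf⟩
  refine ⟨hfa, ?_⟩
  calc modular (fun _ => q) f ≤ ∫⁻ z, (1 + ‖f z‖ₑ ^ p z) ∂dA := by
        refine lintegral_mono fun z => ?_
        rcases le_total ‖f z‖ₑ 1 with h | h
        · exact (ENNReal.rpow_le_one h hq.le).trans le_self_add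
        · exact (ENNReal.rpow_le_rpow_of_exponent_le h (hpq z)).trans le_add_self
    _ = 1 + modular p f := by
        rw [lintegral_add_left measurable_const, lintegral_const, measure_univ, mul_one, modular]
    _ < ⊤ := by simpa using hf

/-- If every function of norm one in `A^q` has finite modular, then `A^q` lies in the variable
exponent space. -/
theorem bergman_eq_of_forall_modular_lt_top {q B : ℝ} {p : ℂ → ℝ} (hq : 0 < q)
    (hpq : ∀ z, q ≤ p z) (hpB : ∀ z, p z ≤ B)
    (h : ∀ f ∈ bergman (fun _ => q), luxNorm (fun _ => q) f = 1 → modular p f < ⊤) :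
    bergman (fun _ => q) = bergman p := by
  refine Subset.antisymm ?_ (bergman_radial_subset hq hpq)
  rintro f ⟨hfa, hf⟩
  refine ⟨hfa, ?_⟩
  have hp0 : ∀ z, 0 < p z := fun z => hq.trans_le (hpq z)
  have hB : 0 ≤ B := (hp0 0).le.trans (hpB 0)
  -- A function of norm zero cannot be normalized; point evaluations show that it vanishes on the
  -- disc.
  rcases eq_or_ne (modular (fun _ => q) f) 0 with h0 | h0
  · have hz : ∀ z ∈ disc, f z = 0 := by
      intro z hz
      have h1 := enorm_rpow_mul_le_modular hq hfa hz
      rw [h0, nonpos_iff_eq_zero, mul_eq_zero, ENNReal.rpow_eq_zero_iff_of_pos hq,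
        enorm_eq_zero, ENNReal.ofReal_eq_zero] at h1
      refine h1.resolve_right ?_
      rw [not_le]
      have := sub_pos.2 (mem_disc.1 hz)
      positivity
    have : modular p f = 0 := by
      rw [modular, ← lintegral_zero (μ := dA)]
      refine lintegral_congr_ae ?_
      filter_upwards [ae_dA_mem_disc] with z hzd
      rw [hz z hzd, enorm_zero, ENNReal.zero_rpow_of_pos (hp0 z)]
    rw [this]
    exact ENNReal.zero_lt_top
  set n := (modular (fun _ => q) f).toReal with hn
  have hn0 : 0 < n := ENNReal.toReal_pos h0 hf.ne
  set t := n ^ (1 / q) with ht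
  have ht0 : 0 < t := by positivity
  have htq : t ^ q = n := by rw [ht, ← rpow_mul hn0.le, one_div_mul_cancel hq.ne', rpow_one]
  have hmod : modular (fun _ => q) (fun z => f z / (t : ℂ)) = 1 := by
    rw [modular_const_div hq ht0, htq, ENNReal.ofReal_inv_of_pos hn0, hn,
      ENNReal.ofReal_toReal hf.ne, ENNReal.mul_inv_cancel h0 hf.ne]
  have hg : (fun z => f z / (t : ℂ)) ∈ bergman (fun _ => q) := by
    refine ⟨fun z hz => (hfa z hz).div analyticAt_const ?_, by rw [hmod]; exact ENNReal.one_lt_top⟩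
    exact_mod_cast ht0.ne'
  have h2 := h _ hg ((luxNorm_const_eq_one_iff hq (by simp [hmod])).2 hmod)
  refine (modular_le_modular_div (fun z => (hp0 z).le) hpB ht0).trans_lt ?_
  exact ENNReal.mul_lt_top
    (ENNReal.rpow_lt_top_of_nonneg hB ENNReal.ofReal_ne_top) h2

/-! ### Averages of the weight over shells. -/

theorem weight_radial_le {P : ℝ → ℝ} {q B y r : ℝ} (hq : 0 < q) (hPB : ∀ r, P r ≤ B)
    (hPq : ∀ r, q ≤ P r) (hy : 0 < y) (hy1 : y ≤ 1) (hr0 : 0 ≤ r) (hr : r ≤ 1 - y) :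
    weight (fun z => P ‖z‖) q r ≤ ENNReal.ofReal ((1 / y) ^ (2 * (B - q) / q)) := by
  rw [weight_radial P q hr0]
  refine ENNReal.ofReal_le_ofReal ?_
  have hu : 0 ≤ 2 * (P r - q) / q := by have := sub_nonneg.2 (hPq r); positivity
  calc 1 / (1 - r) ^ (2 * (P r - q) / q) ≤ 1 / y ^ (2 * (P r - q) / q) := by
        gcongr
        linarith
    _ = (1 / y) ^ (2 * (P r - q) / q) := by rw [div_rpow zero_le_one hy.le, one_rpow]
    _ ≤ (1 / y) ^ (2 * (B - q) / q) := by
        refine rpow_le_rpow_of_exponent_le (by rwa [le_div_iff₀ hy, one_mul]) ?_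
        have := hPB r
        gcongr

/-- The averages over shells that stay away from the boundary are trivially bounded. -/
theorem shell_average_le {P : ℝ → ℝ} {q B x : ℝ} (hq : 0 < q) (hPB : ∀ r, P r ≤ B)
    (hPq : ∀ r, q ≤ P r) (hx : 1 / 2 < x) (hx1 : x ≤ 1) :
    ENNReal.ofReal (2 / x) * ∫⁻ r in Icc (1 - x) (1 - x / 2), weight (fun z => P ‖z‖) q r ≤
      ENNReal.ofReal (4 ^ (2 * (B - q) / q)) := by
  have hx0 : 0 < x := by linarith
  calc ENNReal.ofReal (2 / x) * ∫⁻ r in Icc (1 - x) (1 - x / 2), weight (fun z => P ‖z‖) q r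
      ≤ ENNReal.ofReal (2 / x) * ∫⁻ r in Icc (1 - x) (1 - x / 2),
          ENNReal.ofReal (4 ^ (2 * (B - q) / q)) := by
        gcongr ENNReal.ofReal (2 / x) * ?_
        refine setLIntegral_mono' measurableSet_Icc fun r hr => ?_
        have := weight_radial_le (y := 1 / 4) hq hPB hPq (by norm_num) (by norm_num)
          (by linarith [hr.1] : 0 ≤ r) (by linarith [hr.2])
        rwa [one_div_one_div] at this
    _ = ENNReal.ofReal (4 ^ (2 * (B - q) / q)) := by
        rw [setLIntegral_const, Real.volume_Icc, mul_left_comm, ← ENNReal.ofReal_mul (by positivity)]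
        rw [show 2 / x * (1 - x / 2 - (1 - x)) = 1 by field_simp; ring, ENNReal.ofReal_one, mul_one]

/-- A function that is large on a sector of a shell controls the average of the weight there. -/
theorem shell_average_le_modular {F : ℂ → ℂ} {P : ℝ → ℝ} {q B β ε x : ℝ} (hq : 0 < q)
    (hP : Measurable P) (hPB : ∀ r, P r ≤ B) (hPq : ∀ r, q ≤ P r) (hF : ContinuousOn F disc)
    (hx : 0 < x) (hx1 : x ≤ 1 / 2) (hβ : 0 < β) (hβ1 : β ≤ 1) (hε : 0 < ε) (hε1 : ε ≤ 1)
    (h : ∀ r ∈ Icc (1 - x) (1 - x / 2), ∀ θ ∈ Ioc 0 (ε * x),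
      β * x ^ (-(2 / q)) ≤ ‖F (circleMap 0 r θ)‖) :
    ENNReal.ofReal (2 / x) * ∫⁻ r in Icc (1 - x) (1 - x / 2), weight (fun z => P ‖z‖) q r ≤
      ENNReal.ofReal (4 * π * 2 ^ (2 * (B - q) / q) / (β ^ B * ε)) *
        modular (fun z => P ‖z‖) F := by
  set U := 2 * (B - q) / q with hU
  set D := 4 * π * 2 ^ U / (β ^ B * ε) with hD
  -- With u = 2(P-q)/q, (β x^(-2/q))^P = β^P x^(-2) x^(-u), while the weight is at most (2/x)^u on
  -- the shell. Since β ≤ 1, β^P ≥ β^B; since P ≤ B, 2^u ≤ 2^U.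
  set m := β ^ B / 2 ^ U / x ^ 2 with hm
  have hm0 : 0 < m := by positivity
  have hD0 : 0 < D := by positivity
  have hsub : Icc (1 - x) (1 - x / 2) ⊆ Ioo 0 1 := fun r hr =>
    ⟨by linarith [hr.1], by linarith [hr.2]⟩
  have hpt : ∀ r ∈ Icc (1 - x) (1 - x / 2), ∀ θ ∈ Ioc 0 (ε * x),
      ENNReal.ofReal m * weight (fun z => P ‖z‖) q r ≤ ‖F (circleMap 0 r θ)‖ₑ ^ P r := by
    intro r hr θ hθ
    have hP0 : 0 ≤ P r := hq.le.trans (hPq r)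
    rw [weight_radial P q (hsub hr).1.le, ← ENNReal.ofReal_mul hm0.le, ← ofReal_norm,
      ENNReal.ofReal_rpow_of_nonneg (norm_nonneg _) hP0]
    refine ENNReal.ofReal_le_ofReal ?_
    set u := 2 * (P r - q) / q with hu
    have hu0 : 0 ≤ u := by have := sub_nonneg.2 (hPq r); positivity
    have huU : u ≤ U := by have := hPB r; rw [hu, hU]; gcongr
    calc m * (1 / (1 - r) ^ u) ≤ m * (1 / (x / 2) ^ u) := by
          gcongr
          linarith [hr.2]
      _ = β ^ B * (2 ^ u / 2 ^ U) * (x ^ (-(2 : ℝ)) * x ^ (-u)) := by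
          rw [div_rpow hx.le (by norm_num), hm, rpow_neg hx.le, rpow_neg hx.le, rpow_two]
          field_simp
      _ ≤ β ^ P r * 1 * (x ^ (-(2 : ℝ)) * x ^ (-u)) := by
          refine mul_le_mul_of_nonneg_right
            (mul_le_mul ?_ ?_ (by positivity) (by positivity)) (by positivity)
          · exact rpow_le_rpow_of_exponent_ge hβ hβ1 (hPB r)
          · rw [div_le_one (by positivity)]
            exact rpow_le_rpow_of_exponent_le (by norm_num) huU
      _ = (β * x ^ (-(2 / q))) ^ P r := by
          rw [mul_rpow hβ.le (by positivity), ← rpow_mul hx.le, ← rpow_add hx, mul_one]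
          congr 2
          rw [hu]
          field_simp
          ring
      _ ≤ ‖F (circleMap 0 r θ)‖ ^ P r := by
          gcongr
          exact h r hr θ hθ
  rw [modular_radial_eq hP hF, ← lintegral_const_mul' _ _ ENNReal.ofReal_ne_top, ← mul_assoc,
    ← lintegral_const_mul' _ _ (ENNReal.mul_ne_top ENNReal.ofReal_ne_top (by simp))]
  refine le_trans (setLIntegral_mono' measurableSet_Icc fun r hr => ?_) (lintegral_mono_set hsub)
  have hmean : (ENNReal.ofReal (2 * π))⁻¹ *
      (ENNReal.ofReal m * weight (fun z => P ‖z‖) q r * ENNReal.ofReal (ε * x)) ≤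
      meanPow (P r) r F := by
    rw [meanPow]
    gcongr (ENNReal.ofReal (2 * π))⁻¹ * ?_
    calc ENNReal.ofReal m * weight (fun z => P ‖z‖) q r * ENNReal.ofReal (ε * x)
        = ∫⁻ θ in Ioc 0 (ε * x), ENNReal.ofReal m * weight (fun z => P ‖z‖) q r := by
          rw [setLIntegral_const, Real.volume_Ioc, sub_zero]
      _ ≤ ∫⁻ θ in Ioc 0 (ε * x), ‖F (circleMap 0 r θ)‖ₑ ^ P r :=
          setLIntegral_mono' measurableSet_Ioc (hpt r hr)
      _ ≤ _ := by
          refine lintegral_mono_set (Ioc_subset_Ioc_right ?_)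
          nlinarith [pi_gt_three]
  have h2 : (2 : ℝ≥0∞) = ENNReal.ofReal 2 := by simp
  -- The constant `D` is chosen to make this an equality; the final factor 1/2 is a lower bound for
  -- r, as x ≤ 1/2.
  calc ENNReal.ofReal (2 / x) * weight (fun z => P ‖z‖) q r
      = ENNReal.ofReal D * 2 * ((ENNReal.ofReal (2 * π))⁻¹ *
        (ENNReal.ofReal m * weight (fun z => P ‖z‖) q r * ENNReal.ofReal (ε * x)) *
          ENNReal.ofReal (1 / 2)) := by
        rw [← ENNReal.ofReal_inv_of_pos (by positivity), h2]
        generalize weight (fun z => P ‖z‖) q r = w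
        calc ENNReal.ofReal (2 / x) * w
            = (ENNReal.ofReal D * ENNReal.ofReal 2 * ENNReal.ofReal (2 * π)⁻¹ * ENNReal.ofReal m *
                ENNReal.ofReal (ε * x) * ENNReal.ofReal (1 / 2)) * w := by
              rw [← ENNReal.ofReal_mul (by positivity), ← ENNReal.ofReal_mul (by positivity),
                ← ENNReal.ofReal_mul (by positivity), ← ENNReal.ofReal_mul (by positivity),
                ← ENNReal.ofReal_mul (by positivity)]
              congr 2
              rw [hD, hm]
              field_simp
              ring
          _ = _ := by ring
    _ ≤ ENNReal.ofReal D * 2 * (meanPow (P r) r F * ENNReal.ofReal r) := by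
        gcongr
        linarith [hr.1]

/-! ### Kernels close to the positive radius. -/

theorem norm_ofReal_sub_circleMap_le {r θ : ℝ} (hr0 : 0 ≤ r) (hr : r ≤ 1) :
    ‖(r : ℂ) - circleMap 0 r θ‖ ≤ |θ| := by
  have h1 : (r : ℂ) - circleMap 0 r θ = -(r * (Complex.exp (Complex.I * θ) - 1)) := by
    rw [circleMap_zero, mul_comm Complex.I]; ring
  rw [h1, norm_neg, norm_mul, Complex.norm_real, norm_of_nonneg hr0]
  calc r * ‖Complex.exp (Complex.I * θ) - 1‖ ≤ 1 * |θ| := by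
        gcongr
        exact Real.norm_exp_I_mul_ofReal_sub_one_le
    _ = |θ| := one_mul _

theorem ofReal_mem_disc {l : ℝ} (h0 : 0 ≤ l) (h1 : l < 1) : (l : ℂ) ∈ disc := by
  rwa [mem_disc, Complex.norm_real, norm_of_nonneg h0]

/-- The lower bound for `kernelFun` near its pole. -/
theorem le_norm_kernelFun {q a x r θ : ℝ} (hq : 0 < q) (ha : 2 < a * q) (hx : 0 < x)
    (hx1 : x ≤ 1 / 2) (hr : r ∈ Icc (1 - x) (1 - x / 2)) (hθ : θ ∈ Ioc 0 x) :
    (3 ^ a)⁻¹ * x ^ (-(2 / q)) ≤ ‖kernelFun ((1 - x : ℝ) : ℂ) a q (circleMap 0 r θ)‖ := by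
  have ha' : 2 / q < a := by rwa [div_lt_iff₀ hq]
  have ha0 : 0 < a := lt_trans (by positivity) ha'
  have hr0 : 0 ≤ r := by linarith [hr.1]
  have hr1 : r < 1 := by linarith [hr.2]
  have hl : ((1 - x : ℝ) : ℂ) ∈ disc := ofReal_mem_disc (by linarith) (by linarith)
  have hz : circleMap 0 r θ ∈ disc := circleMap_mem_disc ⟨by linarith [hr.1], hr1⟩ θ
  have hpos : 0 < ‖1 - (starRingEnd ℂ) ((1 - x : ℝ) : ℂ) * circleMap 0 r θ‖ :=
    (sub_pos.2 (mem_disc.1 hl)).trans_le (one_sub_norm_le_norm_one_sub_conj_mul hz)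
  rw [norm_kernelFun hl, Complex.norm_real, norm_of_nonneg (by linarith)]
  -- On the radius the distance is at most 1 - (1-x)² ≤ 2x, and turning by θ ≤ x costs at most
  -- another x.
  have hden : ‖1 - (starRingEnd ℂ) ((1 - x : ℝ) : ℂ) * circleMap 0 r θ‖ ≤ 3 * x := by
    rw [Complex.conj_ofReal]
    have h1 : (1 : ℂ) - ((1 - x : ℝ) : ℂ) * circleMap 0 r θ = ((1 - (1 - x) * r : ℝ) : ℂ) +
        ((1 - x : ℝ) : ℂ) * ((r : ℂ) - circleMap 0 r θ) := by push_cast; ring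
    rw [h1]
    refine (norm_add_le _ _).trans ?_
    rw [norm_mul, Complex.norm_real, Complex.norm_real, norm_of_nonneg (by nlinarith),
      norm_of_nonneg (by linarith)]
    have h2 := norm_ofReal_sub_circleMap_le (θ := θ) hr0 hr1.le
    rw [abs_of_pos hθ.1] at h2
    nlinarith [hθ.2, hr.1, norm_nonneg ((r : ℂ) - circleMap 0 r θ)]
  calc (3 ^ a)⁻¹ * x ^ (-(2 / q)) = x ^ (a - 2 / q) / (3 * x) ^ a := by
        rw [mul_rpow (by norm_num) hx.le, sub_eq_add_neg, rpow_add hx]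
        field_simp
    _ ≤ _ := by
        have h1 : x ≤ 1 - (1 - x) ^ 2 := by nlinarith
        exact div_le_div₀ (rpow_nonneg (hx.le.trans h1) _)
          (rpow_le_rpow hx.le h1 (sub_nonneg.2 ha'.le)) (by positivity)
          (rpow_le_rpow hpos.le hden ha0.le)

/-- Close to the positive radius, all kernels with real parameter have comparable real part and
modulus. -/
theorem half_norm_le_re_kernelFun {q a l x r θ ε : ℝ} (ha : 0 < a) (hl0 : 0 ≤ l) (hl1 : l < 1)
    (hx : 0 < x) (hr0 : 0 < r) (hr : r ≤ 1 - x / 2) (hε : a * ε ≤ 1 / 3)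
    (hθ : θ ∈ Ioc 0 (ε * x)) :
    ‖kernelFun (l : ℂ) a q (circleMap 0 r θ)‖ / 2 ≤
      (kernelFun (l : ℂ) a q (circleMap 0 r θ)).re := by
  have hr1 : r < 1 := by linarith
  have hl : (l : ℂ) ∈ disc := ofReal_mem_disc hl0 hl1
  set ζ : ℂ := 1 - (l : ℂ) * circleMap 0 r θ with hζ
  have hre : circleMap 0 r θ = r * Complex.cos θ + r * Complex.sin θ * Complex.I := by
    rw [circleMap_zero, Complex.exp_mul_I]; ring
  have hζre : ζ.re = 1 - l * (r * cos θ) := by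
    simp [hζ, hre, ← Complex.ofReal_cos, ← Complex.ofReal_sin]
  have hζim : ζ.im = -(l * (r * sin θ)) := by
    simp [hζ, hre, ← Complex.ofReal_cos, ← Complex.ofReal_sin]
  have hlr : l * r ≤ r := by nlinarith
  have hlr0 : 0 ≤ l * r := by positivity
  -- This bound depends on r but not on l, so one sector serves all kernels at once.
  have hζre' : x / 2 ≤ ζ.re := by
    rw [hζre]
    nlinarith [cos_le_one θ]
  have hζ0 : ζ ≠ 0 := fun h0 => by rw [h0, Complex.zero_re] at hζre'; linarith
  have hζnorm : x / 2 ≤ ‖ζ‖ := hζre'.trans (Complex.re_le_norm ζ)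
  have hζpos : 0 < ‖ζ‖ := by linarith
  have him : |ζ.im| ≤ ε * x := by
    rw [hζim, abs_neg, ← mul_assoc, abs_mul, abs_of_nonneg hlr0]
    have h1 : |sin θ| ≤ θ := abs_sin_le_abs.trans_eq (abs_of_pos hθ.1)
    nlinarith [abs_nonneg (sin θ), hθ.2]
  have hε0 : 0 < ε := by
    have := hθ.1.trans_le hθ.2
    exact pos_of_mul_pos_left this hx.le
  -- Jordan's inequality with |sin (arg ζ)| ≤ εx/(x/2). Since aε ≤ 1/3, the argument of ζ^a is then
  -- at most π/3, where the cosine is at least 1/2.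
  have harg : |ζ.arg| ≤ π * ε := by
    have h1 : |ζ.arg| ≤ π / 2 := Complex.abs_arg_le_pi_div_two_iff.2 (by linarith)
    have h2 := mul_abs_le_abs_sin h1
    rw [Complex.sin_arg, abs_div, abs_of_pos hζpos, le_div_iff₀ hζpos] at h2
    have h3 : 2 / π * |ζ.arg| * (x / 2) ≤ ε * x :=
      (mul_le_mul_of_nonneg_left hζnorm (by positivity)).trans (h2.trans him)
    have h4 : 2 / π * |ζ.arg| * (x / 2) = |ζ.arg| / π * x := by ring
    rw [h4] at h3
    have h5 := le_of_mul_le_mul_right h3 hx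
    rwa [div_le_iff₀ pi_pos, mul_comm] at h5
  have hcos : 1 / 2 ≤ cos (a * ζ.arg) := by
    rw [← cos_pi_div_three, ← cos_abs (a * ζ.arg), abs_mul, abs_of_pos ha]
    refine cos_le_cos_of_nonneg_of_le_pi (by positivity) (by linarith [pi_pos]) ?_
    nlinarith [mul_le_mul_of_nonneg_left harg ha.le, pi_pos]
  have hkey : ‖(ζ ^ (a : ℂ))⁻¹‖ / 2 ≤ ((ζ ^ (a : ℂ))⁻¹).re := by
    rw [← Complex.cpow_neg, Complex.cpow_def_of_ne_zero hζ0, Complex.norm_exp, Complex.exp_re]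
    have h1 : (Complex.log ζ * -(a : ℂ)).im = -(a * ζ.arg) := by
      simp [Complex.log_im, mul_comm]
    rw [h1, cos_neg]
    nlinarith [Real.exp_pos (Complex.log ζ * -(a : ℂ)).re]
  have hK : kernelFun (l : ℂ) a q (circleMap 0 r θ) =
      (((1 - ‖(l : ℂ)‖ ^ 2) ^ (a - 2 / q) : ℝ) : ℂ) * (ζ ^ (a : ℂ))⁻¹ := by
    rw [kernelFun, Complex.conj_ofReal, div_eq_mul_inv]
  have hc : 0 ≤ (1 - ‖(l : ℂ)‖ ^ 2) ^ (a - 2 / q) := rpow_nonneg (one_sub_norm_sq_pos hl).le _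
  rw [hK, norm_mul, Complex.norm_real, norm_of_nonneg hc, Complex.re_ofReal_mul, mul_div_assoc]
  gcongr

/-! ### Series of kernels without cancellation. -/

/-- Each term is at most the ℓ^q norm of b. This replaces the triangle inequality in L^q and covers
q < 1 as well. -/
theorem tsum_geometric_mul_rpow_le {q : ℝ} (hq : 0 < q) (b : ℕ → ℝ≥0∞) :
    (∑' n, (2⁻¹ : ℝ≥0∞) ^ n * b n) ^ q ≤ 2 ^ q * ∑' n, b n ^ q := by
  set S := ∑' n, b n ^ q with hS
  have h1 : ∀ n, b n ≤ S ^ (1 / q) := by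
    intro n
    calc b n = (b n ^ q) ^ (1 / q) := by
          rw [← ENNReal.rpow_mul, mul_one_div_cancel hq.ne', ENNReal.rpow_one]
      _ ≤ S ^ (1 / q) := ENNReal.rpow_le_rpow (ENNReal.le_tsum n) (by positivity)
  calc (∑' n, (2⁻¹ : ℝ≥0∞) ^ n * b n) ^ q ≤ (∑' n, (2⁻¹ : ℝ≥0∞) ^ n * S ^ (1 / q)) ^ q := by
        gcongr with n
        exact h1 n
    _ = 2 ^ q * S := by
        rw [ENNReal.tsum_mul_right, ENNReal.tsum_geometric, ENNReal.one_sub_inv_two, inv_inv,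
          ENNReal.mul_rpow_of_nonneg _ _ hq.le, ← ENNReal.rpow_mul, one_div_mul_cancel hq.ne',
          ENNReal.rpow_one]

theorem aemeasurable_dA {F : ℂ → ℝ≥0∞} (hF : Measurable (disc.indicator F)) : AEMeasurable F dA := by
  refine ⟨_, hF, ?_⟩
  filter_upwards [ae_dA_mem_disc] with z hz
  rw [indicator_of_mem hz]

/-- A geometrically weighted sum of kernels. -/
noncomputable def kernelSeries (l : ℕ → ℝ) (a q : ℝ) (z : ℂ) : ℂ :=
  ∑' n, (1 / 4 : ℂ) ^ n * kernelFun (l n : ℂ) a q z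

theorem norm_kernelFun_le {w z : ℂ} {a q R : ℝ} (hq : 0 < q) (ha : 2 < a * q) (hw : w ∈ disc)
    (hR : R < 1) (hz : ‖z‖ ≤ R) : ‖kernelFun w a q z‖ ≤ ((1 - R) ^ a)⁻¹ := by
  have ha' : 2 / q < a := by rwa [div_lt_iff₀ hq]
  have ha0 : 0 < a := lt_trans (by positivity) ha'
  have hR' : 0 < 1 - R := sub_pos.2 hR
  have h1 : 1 - R ≤ ‖1 - (starRingEnd ℂ) w * z‖ := by
    have h2 := norm_sub_norm_le (1 : ℂ) ((starRingEnd ℂ) w * z)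
    rw [norm_mul, RCLike.norm_conj, norm_one] at h2
    have := mem_disc.1 hw
    nlinarith [norm_nonneg z]
  rw [norm_kernelFun hw, ← one_div]
  refine div_le_div₀ zero_le_one ?_ (by positivity) (rpow_le_rpow hR'.le h1 ha0.le)
  exact rpow_le_one (one_sub_norm_sq_pos hw).le (by nlinarith [norm_nonneg w])
    (sub_nonneg.2 ha'.le)

theorem norm_kernelSeries_term_le {l : ℕ → ℝ} {q a R : ℝ} (hq : 0 < q) (ha : 2 < a * q)
    (hl : ∀ n, (l n : ℂ) ∈ disc) (hR : R < 1) {z : ℂ} (hz : ‖z‖ ≤ R) (n : ℕ) :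
    ‖(1 / 4 : ℂ) ^ n * kernelFun (l n : ℂ) a q z‖ ≤ (1 / 4) ^ n * ((1 - R) ^ a)⁻¹ := by
  rw [norm_mul, norm_pow]
  have : ‖(1 / 4 : ℂ)‖ = 1 / 4 := by norm_num
  rw [this]
  gcongr
  exact norm_kernelFun_le hq ha (hl n) hR hz

theorem summable_kernelSeries_bound (c : ℝ) : Summable fun n : ℕ => (1 / 4 : ℝ) ^ n * c :=
  (summable_geometric_of_lt_one (by norm_num) (by norm_num)).mul_right c

theorem analyticOnNhd_kernelSeries {l : ℕ → ℝ} {q a : ℝ} (hq : 0 < q) (ha : 2 < a * q)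
    (hl : ∀ n, (l n : ℂ) ∈ disc) : AnalyticOnNhd ℂ (kernelSeries l a q) disc := by
  intro z hz
  obtain ⟨R, hzR, hR⟩ := exists_between (mem_disc.1 hz)
  have hd : DifferentiableOn ℂ (kernelSeries l a q) (ball 0 R) := by
    refine Complex.differentiableOn_tsum_of_summable_norm (summable_kernelSeries_bound ((1 - R) ^ a)⁻¹)
      (fun n => ?_) isOpen_ball fun n w hw => ?_
    · exact ((analyticOnNhd_kernelFun (hl n) a q).differentiableOn.mono
        (ball_subset_ball hR.le)).const_mul _
    · exact norm_kernelSeries_term_le hq ha hl hR (mem_ball_zero_iff.1 hw).le n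
  exact hd.analyticAt (isOpen_ball.mem_nhds (mem_ball_zero_iff.2 hzR))

/-- Write 4^(-n) = 2^(-n) 2^(-n): one factor is spent on `tsum_geometric_mul_rpow_le`, the other
makes the sum of the uniformly bounded modulars converge. -/
theorem modular_kernelSeries_lt_top {l : ℕ → ℝ} {q a : ℝ} (hq : 0 < q) (ha : 2 < a * q)
    (hl : ∀ n, (l n : ℂ) ∈ disc) : modular (fun _ => q) (kernelSeries l a q) < ⊤ := by
  obtain ⟨C, hC⟩ := exists_modular_kernelFun_le hq ha
  set b : ℕ → ℂ → ℝ≥0∞ := fun n z => (2⁻¹ : ℝ≥0∞) ^ n * ‖kernelFun (l n : ℂ) a q z‖ₑ with hb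
  have hpt : ∀ z, ‖kernelSeries l a q z‖ₑ ≤ ∑' n, (2⁻¹ : ℝ≥0∞) ^ n * b n z := by
    intro z
    refine enorm_tsum_le_tsum_enorm.trans (ENNReal.tsum_le_tsum fun n => ?_)
    rw [enorm_mul, enorm_pow, ← mul_assoc, ← mul_pow]
    gcongr
    rw [← ofReal_norm, ← ENNReal.mul_inv (by simp) (by simp),
      show ‖(1 / 4 : ℂ)‖ = (4 : ℝ)⁻¹ by norm_num, ENNReal.ofReal_inv_of_pos (by norm_num)]
    norm_num
  set ρ : ℝ≥0∞ := (2⁻¹ : ℝ≥0∞) ^ q with hρ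
  have hρ1 : ρ < 1 := ENNReal.rpow_lt_one (by simp) hq
  have hbq : ∀ n z, b n z ^ q = ρ ^ n * ‖kernelFun (l n : ℂ) a q z‖ₑ ^ q := by
    intro n z
    rw [hb, ENNReal.mul_rpow_of_nonneg _ _ hq.le, hρ, ← ENNReal.rpow_natCast,
      ← ENNReal.rpow_natCast, ← ENNReal.rpow_mul, ← ENNReal.rpow_mul, mul_comm q]
  have hρn : ∀ n, ρ ^ n ≠ ⊤ := fun n => ENNReal.pow_ne_top (hρ1.trans ENNReal.one_lt_top).ne
  calc modular (fun _ => q) (kernelSeries l a q)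
      ≤ ∫⁻ z, 2 ^ q * ∑' n, b n z ^ q ∂dA := by
        refine lintegral_mono fun z => ?_
        exact (ENNReal.rpow_le_rpow (hpt z) hq.le).trans (tsum_geometric_mul_rpow_le hq _)
    _ = 2 ^ q * ∑' n, ρ ^ n * modular (fun _ => q) (kernelFun (l n : ℂ) a q) := by
        rw [lintegral_const_mul' _ _ (ENNReal.rpow_ne_top_of_nonneg hq.le (by simp))]
        simp only [hbq]
        rw [lintegral_tsum]
        · simp only [modular, lintegral_const_mul' _ _ (hρn _)]
        · intro n
          refine AEMeasurable.const_mul (aemeasurable_dA ?_) _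
          exact measurable_indicator_enorm_rpow (P := fun _ => q) measurable_const
            (analyticOnNhd_kernelFun (hl n) a q).continuousOn
    _ ≤ 2 ^ q * ∑' n, ρ ^ n * C := by
        gcongr with n
        exact hC _ (hl n)
    _ < ⊤ := by
        rw [ENNReal.tsum_mul_right, ENNReal.tsum_geometric]
        refine ENNReal.mul_lt_top (ENNReal.rpow_lt_top_of_nonneg hq.le (by simp)) ?_
        refine ENNReal.mul_lt_top ?_ ENNReal.coe_lt_top
        rw [ENNReal.inv_lt_top]
        exact tsub_pos_of_lt hρ1

/-- There is no cancellation in the series of kernels close to the positive radius. -/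
theorem le_norm_kernelSeries {x : ℕ → ℝ} {q a ε : ℝ} (hq : 0 < q) (ha : 2 < a * q)
    (hε1 : ε ≤ 1) (hε : a * ε ≤ 1 / 3) (hx : ∀ n, 0 < x n) (hx1 : ∀ n, x n ≤ 1 / 2) (n : ℕ)
    {r θ : ℝ} (hr : r ∈ Icc (1 - x n) (1 - x n / 2)) (hθ : θ ∈ Ioc 0 (ε * x n)) :
    ((1 / 4) ^ n * (3 ^ a)⁻¹ / 2) * x n ^ (-(2 / q)) ≤
      ‖kernelSeries (fun k => 1 - x k) a q (circleMap 0 r θ)‖ := by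
  have ha0 : 0 < a := by
    by_contra h
    nlinarith
  have hr0 : 0 < r := by linarith [hr.1, hx1 n]
  have hr1 : r < 1 := by linarith [hr.2, hx n]
  have hl : ∀ k, ((1 - x k : ℝ) : ℂ) ∈ disc := fun k =>
    ofReal_mem_disc (by linarith [hx1 k]) (by linarith [hx k])
  have hsum : Summable fun k => (1 / 4 : ℂ) ^ k * kernelFun ((1 - x k : ℝ) : ℂ) a q
      (circleMap 0 r θ) := by
    refine Summable.of_norm_bounded (summable_kernelSeries_bound _) fun k =>
      norm_kernelSeries_term_le (R := r) hq ha hl hr1 ?_ k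
    rw [norm_circleMap_zero, abs_of_pos hr0]
  have hre : ∀ k, ((1 / 4 : ℂ) ^ k * kernelFun ((1 - x k : ℝ) : ℂ) a q (circleMap 0 r θ)).re =
      (1 / 4) ^ k * (kernelFun ((1 - x k : ℝ) : ℂ) a q (circleMap 0 r θ)).re := by
    intro k
    rw [show (1 / 4 : ℂ) ^ k = (((1 / 4) ^ k : ℝ) : ℂ) by push_cast; rfl, Complex.re_ofReal_mul]
  have hhalf : ∀ k, ‖kernelFun ((1 - x k : ℝ) : ℂ) a q (circleMap 0 r θ)‖ / 2 ≤
      (kernelFun ((1 - x k : ℝ) : ℂ) a q (circleMap 0 r θ)).re := fun k =>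
    half_norm_le_re_kernelFun ha0 (by linarith [hx1 k]) (by linarith [hx k]) (hx n) hr0 hr.2 hε hθ
  have hθ' : θ ∈ Ioc 0 (x n) := ⟨hθ.1, hθ.2.trans (by nlinarith [hx n])⟩
  calc ((1 / 4) ^ n * (3 ^ a)⁻¹ / 2) * x n ^ (-(2 / q))
      = (1 / 4) ^ n * (((3 ^ a)⁻¹ * x n ^ (-(2 / q))) / 2) := by ring
    _ ≤ (1 / 4) ^ n * (kernelFun ((1 - x n : ℝ) : ℂ) a q (circleMap 0 r θ)).re := by
        gcongr
        refine le_trans ?_ (hhalf n)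
        gcongr
        exact le_norm_kernelFun hq ha (hx n) (hx1 n) hr hθ'
    -- All other terms have nonnegative real part and may be dropped from the sum.
    _ ≤ ∑' k, ((1 / 4 : ℂ) ^ k * kernelFun ((1 - x k : ℝ) : ℂ) a q (circleMap 0 r θ)).re := by
        rw [← hre n]
        refine (Complex.reCLM.summable hsum).le_tsum n fun k _ => ?_
        change 0 ≤ ((1 / 4 : ℂ) ^ k * kernelFun ((1 - x k : ℝ) : ℂ) a q (circleMap 0 r θ)).re
        rw [hre k]
        have := (by positivity : (0 : ℝ) ≤ _ / 2).trans (hhalf k)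
        positivity
    _ = (kernelSeries (fun k => 1 - x k) a q (circleMap 0 r θ)).re :=
        (Complex.reCLM.map_tsum hsum).symm
    _ ≤ _ := Complex.re_le_norm _

/-! ### Necessity of the shell condition. -/

/-- For x ≤ 1/2 the single kernel with parameter 1 - x detects the shell; for larger x the weight is
bounded outright. -/
theorem exists_shell_bound_of_modular_kernelFun_le {P : ℝ → ℝ} {q B a : ℝ} (hq : 0 < q)
    (hP : Measurable P) (hPB : ∀ r, P r ≤ B) (hPq : ∀ r, q ≤ P r) (ha : 2 < a * q) {C : ℝ≥0}
    (hC : ∀ w ∈ disc, modular (fun z => P ‖z‖) (kernelFun w a q) ≤ C) :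
    ∃ K : ℝ≥0, ∀ x : ℝ, 0 < x → x ≤ 1 → ENNReal.ofReal (2 / x) *
      ∫⁻ r in Icc (1 - x) (1 - x / 2), weight (fun z => P ‖z‖) q r ≤ K := by
  have ha0 : 0 < a := by
    by_contra h
    nlinarith
  set β : ℝ := (3 ^ a)⁻¹ with hβ
  set D : ℝ := 4 * π * 2 ^ (2 * (B - q) / q) / (β ^ B * 1) with hD
  refine ⟨max (4 ^ (2 * (B - q) / q) : ℝ).toNNReal (D.toNNReal * C), fun x hx hx1 => ?_⟩
  rcases le_or_gt x (1 / 2) with hx2 | hx2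
  · have hl : ((1 - x : ℝ) : ℂ) ∈ disc := ofReal_mem_disc (by linarith) (by linarith)
    refine (shell_average_le_modular hq hP hPB hPq
      (analyticOnNhd_kernelFun hl a q).continuousOn hx hx2 (β := β) (by positivity)
      (inv_le_one_of_one_le₀ (one_le_rpow (by norm_num) ha0.le)) one_pos le_rfl
      fun r hr θ hθ => ?_).trans ?_
    · rw [one_mul] at hθ
      exact le_norm_kernelFun hq ha hx hx2 hr hθ
    · rw [ENNReal.coe_max]
      refine le_trans ?_ (le_max_right _ _)
      rw [ENNReal.coe_mul]
      exact mul_le_mul' le_rfl (hC _ hl)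
  · refine (shell_average_le hq hPB hPq hx2 hx1).trans ?_
    rw [ENNReal.coe_max]
    exact le_max_left _ _

/-- If the two Bergman spaces agree, the averages of the weight over shells are bounded. -/
theorem exists_shell_bound_of_bergman_eq {P : ℝ → ℝ} {q B : ℝ} (hq : 0 < q)
    (hP : Measurable P) (hPB : ∀ r, P r ≤ B) (hPq : ∀ r, q ≤ P r)
    (h : bergman (fun _ => q) = bergman (fun z => P ‖z‖)) :
    ∃ K : ℝ≥0, ∀ x : ℝ, 0 < x → x ≤ 1 → ENNReal.ofReal (2 / x) *
      ∫⁻ r in Icc (1 - x) (1 - x / 2), weight (fun z => P ‖z‖) q r ≤ K := by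
  by_contra! hcon
  set a : ℝ := 3 / q with ha
  have ha0 : 0 < a := by positivity
  have haq : 2 < a * q := by rw [ha, div_mul_cancel₀ _ hq.ne']; norm_num
  set ε : ℝ := 1 / (3 * (a + 1)) with hε
  have hε0 : 0 < ε := by positivity
  have hε1 : ε ≤ 1 := by rw [hε, div_le_one (by positivity)]; linarith
  have haε : a * ε ≤ 1 / 3 := by
    rw [hε, mul_one_div, div_le_div_iff₀ (by positivity) (by norm_num)]; linarith
  set β : ℕ → ℝ := fun n => (1 / 4) ^ n * (3 ^ a)⁻¹ / 2 with hβ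
  have hβ0 : ∀ n, 0 < β n := fun n => by positivity
  have hβ1 : ∀ n, β n ≤ 1 := by
    intro n
    have h1 : ((3 : ℝ) ^ a)⁻¹ ≤ 1 := inv_le_one_of_one_le₀ (one_le_rpow (by norm_num) ha0.le)
    have h2 : ((1 : ℝ) / 4) ^ n ≤ 1 := pow_le_one₀ (by norm_num) (by norm_num)
    have h3 : ((1 : ℝ) / 4) ^ n * (3 ^ a)⁻¹ ≤ 1 := mul_le_one₀ h2 (by positivity) h1
    simp only [hβ]
    linarith
  set D : ℕ → ℝ := fun n => 4 * π * 2 ^ (2 * (B - q) / q) / (β n ^ B * ε) with hD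
  -- Gliding hump: `D n` absorbs the small coefficient 4^(-n) and is fixed before x n is chosen, so
  -- the n-th shell forces the modular of the series above n. The first entry of the maximum forces
  -- x n ≤ 1/2.
  choose x hx0 hx1 hx using fun n : ℕ =>
    hcon (max (4 ^ (2 * (B - q) / q) : ℝ).toNNReal ((D n).toNNReal * n))
  have hx2 : ∀ n, x n ≤ 1 / 2 := by
    intro n
    by_contra! hlt
    refine absurd ((hx n).trans_le (shell_average_le hq hPB hPq hlt (hx1 n))) (not_lt.2 ?_)
    rw [ENNReal.coe_max]
    exact le_max_left _ _
  have hl : ∀ n, ((1 - x n : ℝ) : ℂ) ∈ disc := fun n =>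
    ofReal_mem_disc (by linarith [hx2 n]) (by linarith [hx0 n])
  set f := kernelSeries (fun k => 1 - x k) a q with hf
  have hfa : AnalyticOnNhd ℂ f disc := analyticOnNhd_kernelSeries hq haq hl
  have hfq : f ∈ bergman (fun _ => q) := ⟨hfa, modular_kernelSeries_lt_top hq haq hl⟩
  rw [h] at hfq
  obtain ⟨n, hn⟩ := ENNReal.exists_nat_gt hfq.2.ne
  have h1 := shell_average_le_modular hq hP hPB hPq hfa.continuousOn (hx0 n) (hx2 n) (hβ0 n) (hβ1 n)
    hε0 hε1 fun r hr θ hθ => le_norm_kernelSeries hq haq hε1 haε hx0 hx2 n hr hθ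
  have h2 : ENNReal.ofReal (D n) * modular (fun z => P ‖z‖) f ≤ ENNReal.ofReal (D n) * n :=
    mul_le_mul' le_rfl hn.le
  refine absurd ((hx n).trans_le (h1.trans h2)) (not_lt.2 ?_)
  rw [ENNReal.coe_max]
  refine le_trans ?_ (le_max_right _ _)
  rw [ENNReal.coe_mul]
  exact le_rfl

/-! ### Passage to the profile and the equivalences. -/

theorem setLIntegral_congr_weight {p p' : ℂ → ℝ} {q : ℝ}
    (h : ∀ᵐ r : ℝ ∂volume.restrict (Ioo (0 : ℝ) 1), p (r : ℂ) = p' (r : ℂ)) {S : Set ℝ}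
    (hS : S ⊆ Ico 0 1) : ∫⁻ r in S, weight p q r = ∫⁻ r in S, weight p' q r := by
  rw [Measure.restrict_congr_set Ioo_ae_eq_Ico] at h
  refine lintegral_congr_ae ?_
  filter_upwards [ae_restrict_of_ae_restrict_of_subset hS h] with r hr
  rw [weight, weight, hr]

end VarBergman

theorem mainTheorem1 (q : ℝ) (hq : 0 < q) (p : ℂ → ℝ)
    (hp : VarBergman.IsVariableExponent p) (hrad : VarBergman.IsRadial p)
    (hqp : ∀ᵐ z ∂VarBergman.dA, q ≤ p z) :
    List.TFAE [
      -- (i)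
      VarBergman.bergman (fun _ => q) = VarBergman.bergman p,
      -- (ii), with a constant independent of the function
      ∃ K : ℝ≥0, ∀ f ∈ VarBergman.bergman (fun _ => q), VarBergman.luxNorm (fun _ => q) f = 1 →
        ∫⁻ r in Ioo (0 : ℝ) 1, VarBergman.meanPow (p (r : ℂ)) r f * ENNReal.ofReal r ≤
          K * ∫⁻ r in Ioo (0 : ℝ) 1, VarBergman.meanPow q r f * ENNReal.ofReal r,
      -- (ii), with a constant that may depend on the function
      ∀ f ∈ VarBergman.bergman (fun _ => q), VarBergman.luxNorm (fun _ => q) f = 1 → ∃ K : ℝ≥0,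
        ∫⁻ r in Ioo (0 : ℝ) 1, VarBergman.meanPow (p (r : ℂ)) r f * ENNReal.ofReal r ≤
          K * ∫⁻ r in Ioo (0 : ℝ) 1, VarBergman.meanPow q r f * ENNReal.ofReal r,
      -- (iii), with a constant independent of the function
      ∃ K : ℝ≥0, ∀ f ∈ VarBergman.bergman (fun _ => q),
        ∫⁻ r in Ioo (0 : ℝ) 1,
            VarBergman.weight p q r * VarBergman.meanPow q r f * ENNReal.ofReal r ≤
          K * ∫⁻ r in Ioo (0 : ℝ) 1, VarBergman.meanPow q r f * ENNReal.ofReal r,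
      -- (iii), with a constant that may depend on the function
      ∀ f ∈ VarBergman.bergman (fun _ => q), ∃ K : ℝ≥0,
        ∫⁻ r in Ioo (0 : ℝ) 1,
            VarBergman.weight p q r * VarBergman.meanPow q r f * ENNReal.ofReal r ≤
          K * ∫⁻ r in Ioo (0 : ℝ) 1, VarBergman.meanPow q r f * ENNReal.ofReal r,
      -- (iv)
      ∃ K : ℝ≥0, ∀ g : ℝ → ℝ, (∀ r ∈ Ico (0 : ℝ) 1, 0 ≤ g r) → MonotoneOn g (Ico (0 : ℝ) 1) →
        (∀ r ∈ Ioo (0 : ℝ) 1, ContinuousWithinAt g (Iic r) r) →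
        ∫⁻ r in Ioo (0 : ℝ) 1, VarBergman.weight p q r * ENNReal.ofReal (g r) ≤
          K * ∫⁻ r in Ioo (0 : ℝ) 1, ENNReal.ofReal (g r),
      -- (v)
      ∃ K : ℝ≥0, ∀ x : ℝ, 0 < x → x ≤ 1 →
        ENNReal.ofReal (1 / x) * ∫⁻ r in Ico (1 - x) 1, VarBergman.weight p q r ≤ K,
      -- (vi)
      ∃ K : ℝ≥0, ∀ x : ℝ, 0 < x → x ≤ 1 →
        ENNReal.ofReal (2 / x) * ∫⁻ r in Icc (1 - x) (1 - x / 2), VarBergman.weight p q r ≤ K,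
      -- (vii)
      ∃ a : ℝ, 2 < a * q ∧ ∃ C : ℝ≥0, ∀ w ∈ VarBergman.disc,
        VarBergman.modular p (VarBergman.kernelFun w a q) ≤ C,
      -- (viii)
      ∀ a : ℝ, 2 < a * q → ∃ C : ℝ≥0, ∀ w ∈ VarBergman.disc,
        VarBergman.modular p (VarBergman.kernelFun w a q) ≤ C] := by
  obtain ⟨P, B, hP, hPq, hPB, hPr, hPz⟩ := hp.exists_profile hrad hqp
  have hPr' : ∀ᵐ r : ℝ ∂volume.restrict (Ioo (0 : ℝ) 1), p (r : ℂ) = P ‖(r : ℂ)‖ := by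
    filter_upwards [hPr, ae_restrict_mem measurableSet_Ioo] with r hr hr'
    rw [hr, Complex.norm_real, Real.norm_of_nonneg hr'.1.le]
  set W := VarBergman.weight (fun z => P ‖z‖) q with hW
  have hWm : Measurable W := VarBergman.measurable_weight_radial hP q
  have hmod : ∀ f, VarBergman.modular p f = VarBergman.modular (fun z => P ‖z‖) f := fun f =>
    lintegral_congr_ae (by filter_upwards [hPz] with z hz; rw [hz])
  have hberg : VarBergman.bergman p = VarBergman.bergman (fun z => P ‖z‖) := by
    simp only [VarBergman.bergman, hmod]
  have hmean : ∀ f, ∫⁻ r in Ioo (0 : ℝ) 1,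
      VarBergman.meanPow (p (r : ℂ)) r f * ENNReal.ofReal r =
        ∫⁻ r in Ioo (0 : ℝ) 1, VarBergman.meanPow (P r) r f * ENNReal.ofReal r := fun f =>
    lintegral_congr_ae (by filter_upwards [hPr] with r hr; rw [hr])
  have hWr : ∀ᵐ r : ℝ ∂volume.restrict (Ioo (0 : ℝ) 1), VarBergman.weight p q r = W r := by
    filter_upwards [hPr'] with r hr
    rw [hW, VarBergman.weight, VarBergman.weight, hr]
  have hWmean : ∀ f, ∫⁻ r in Ioo (0 : ℝ) 1,
      VarBergman.weight p q r * VarBergman.meanPow q r f * ENNReal.ofReal r =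
        ∫⁻ r in Ioo (0 : ℝ) 1, W r * VarBergman.meanPow q r f * ENNReal.ofReal r := fun f =>
    lintegral_congr_ae (by filter_upwards [hWr] with r hr; rw [hr])
  have hWg : ∀ g : ℝ → ℝ, ∫⁻ r in Ioo (0 : ℝ) 1, VarBergman.weight p q r * ENNReal.ofReal (g r) =
      ∫⁻ r in Ioo (0 : ℝ) 1, W r * ENNReal.ofReal (g r) := fun g =>
    lintegral_congr_ae (by filter_upwards [hWr] with r hr; rw [hr])
  have hWIco : ∀ x : ℝ, x ≤ 1 → ∫⁻ r in Ico (1 - x) 1, VarBergman.weight p q r =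
      ∫⁻ r in Ico (1 - x) 1, W r := fun x hx =>
    VarBergman.setLIntegral_congr_weight hPr' (Ico_subset_Ico_left (by linarith))
  have hWIcc : ∀ x : ℝ, 0 < x → x ≤ 1 → ∫⁻ r in Icc (1 - x) (1 - x / 2), VarBergman.weight p q r =
      ∫⁻ r in Icc (1 - x) (1 - x / 2), W r := fun x hx hx1 =>
    VarBergman.setLIntegral_congr_weight hPr' fun r hr =>
      ⟨by linarith [hr.1], by linarith [hr.2]⟩
  have hnorm : ∀ f ∈ VarBergman.bergman (fun _ => q), VarBergman.luxNorm (fun _ => q) f = 1 →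
      VarBergman.modular (fun _ => q) f = 1 := fun f hf h =>
    (VarBergman.luxNorm_const_eq_one_iff hq hf.2.ne).1 h
  have hgrowth : ∀ f, AnalyticOnNhd ℂ f VarBergman.disc → ∀ C : ℝ≥0, 1 ≤ C →
      VarBergman.modular (fun _ => q) f ≤ C →
      ∫⁻ r in Ioo (0 : ℝ) 1, VarBergman.meanPow (P r) r f * ENNReal.ofReal r ≤
        (C : ℝ≥0∞) ^ ((B - q) / q) * ∫⁻ r in Ioo (0 : ℝ) 1,
          W r * VarBergman.meanPow q r f * ENNReal.ofReal r := fun f hfa C hC hfC =>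
    VarBergman.lintegral_meanPow_le_lintegral_weight hq hPq hPB hC hfa hfC
  have hgrowth_one : ∀ f ∈ VarBergman.bergman (fun _ => q), VarBergman.luxNorm (fun _ => q) f = 1 →
      ∫⁻ r in Ioo (0 : ℝ) 1, VarBergman.meanPow (P r) r f * ENNReal.ofReal r ≤
        ∫⁻ r in Ioo (0 : ℝ) 1, W r * VarBergman.meanPow q r f * ENNReal.ofReal r := by
    intro f hf h1
    have := hgrowth f hf.1 1 le_rfl (by rw [hnorm f hf h1, ENNReal.coe_one])
    rwa [ENNReal.coe_one, ENNReal.one_rpow, one_mul] at this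
  have hBq : 0 ≤ (B - q) / q := div_nonneg (sub_nonneg.2 ((hPq 0).trans (hPB 0))) hq.le
  -- Entries 2 and 3, and likewise 4 and 5, are the uniform and the function-dependent versions of
  -- one condition; the weakest, 3, still gives 1 because only finiteness for each f is needed.
  tfae_have 1 → 8 := by
    intro h
    obtain ⟨K, hK⟩ :=
      VarBergman.exists_shell_bound_of_bergman_eq hq hP hPB hPq (h.trans hberg)
    exact ⟨K, fun x hx hx1 => by rw [hWIcc x hx hx1]; exact hK x hx hx1⟩
  tfae_have 8 → 7 := by
    rintro ⟨K, hK⟩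
    refine ⟨K, fun x hx hx1 => ?_⟩
    rw [hWIco x hx1]
    refine VarBergman.setLIntegral_Ico_le_of_dyadic (fun y hy hy1 => ?_) hx hx1
    rw [← hWIcc y hy hy1]
    exact hK y hy hy1
  tfae_have 7 → 6 := by
    rintro ⟨K, hK⟩
    refine ⟨K, fun g hg0 hg _ => ?_⟩
    rw [hWg]
    refine VarBergman.lintegral_mul_monotone_le hWm (fun x hx hx1 => ?_)
      (fun r hr => hg0 r (Ioo_subset_Ico_self hr)) (hg.mono Ioo_subset_Ico_self)
    rw [← hWIco x hx1]
    exact hK x hx hx1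
  tfae_have 6 → 7 := by
    rintro ⟨K, hK⟩
    refine ⟨K, fun x hx hx1 => ?_⟩
    rw [hWIco x hx1]
    refine VarBergman.setLIntegral_Ico_le_of_monotone (fun g hg0 hg hgc => ?_) hx hx1
    rw [← hWg]
    exact hK g hg0 hg hgc
  tfae_have 7 → 4 := by
    rintro ⟨K, hK⟩
    refine ⟨K, fun f hf => ?_⟩
    rw [hWmean]
    refine VarBergman.lintegral_mul_meanPow_le hWm (fun x hx hx1 => ?_) hq hf.1
    rw [← hWIco x hx1]
    exact hK x hx hx1
  tfae_have 4 → 5 := fun ⟨K, hK⟩ f hf => ⟨K, hK f hf⟩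
  tfae_have 4 → 2 := by
    rintro ⟨K, hK⟩
    refine ⟨K, fun f hf h1 => ?_⟩
    rw [hmean]
    refine (hgrowth_one f hf h1).trans ?_
    rw [← hWmean]
    exact hK f hf
  tfae_have 5 → 3 := by
    intro h f hf h1
    obtain ⟨K, hK⟩ := h f hf
    refine ⟨K, ?_⟩
    rw [hmean]
    refine (hgrowth_one f hf h1).trans ?_
    rw [← hWmean]
    exact hK
  tfae_have 2 → 3 := fun ⟨K, hK⟩ f hf h1 => ⟨K, hK f hf h1⟩
  tfae_have 3 → 1 := by
    intro h
    rw [hberg]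
    refine VarBergman.bergman_eq_of_forall_modular_lt_top hq (fun z => hPq ‖z‖) (fun z => hPB ‖z‖)
      fun f hf h1 => ?_
    obtain ⟨K, hK⟩ := h f hf h1
    rw [hmean] at hK
    rw [VarBergman.modular_radial_eq hP hf.1.continuousOn]
    have h2 := hf.2
    rw [VarBergman.modular_const_eq hf.1.continuousOn] at h2
    have h3 : ∫⁻ r in Ioo (0 : ℝ) 1, VarBergman.meanPow q r f * ENNReal.ofReal r < ⊤ :=
      ENNReal.lt_top_of_mul_ne_top_right h2.ne (by simp)
    exact ENNReal.mul_lt_top (by simp) (hK.trans_lt (ENNReal.mul_lt_top ENNReal.coe_lt_top h3))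
  tfae_have 4 → 10 := by
    rintro ⟨K, hK⟩ a ha
    obtain ⟨C, hC⟩ := VarBergman.exists_modular_kernelFun_le hq ha
    -- The growth estimate needs a norm bound of at least 1 so that its power increases with the
    -- exponent.
    refine ⟨(max 1 C) ^ ((B - q) / q) * K * max 1 C, fun w hw => ?_⟩
    have hfa := VarBergman.analyticOnNhd_kernelFun hw a q
    have hfC : VarBergman.modular (fun _ => q) (VarBergman.kernelFun w a q) ≤ (max 1 C : ℝ≥0) :=
      (hC w hw).trans (ENNReal.coe_le_coe.2 (le_max_right _ _))
    have h1 := hgrowth _ hfa (max 1 C) (le_max_left _ _) hfC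
    have h2 := hK _ ⟨hfa, hfC.trans_lt ENNReal.coe_lt_top⟩
    rw [hWmean] at h2
    rw [VarBergman.modular_const_eq hfa.continuousOn] at hfC
    rw [hmod, VarBergman.modular_radial_eq hP hfa.continuousOn, ENNReal.coe_mul, ENNReal.coe_mul,
      ENNReal.coe_rpow_of_nonneg _ hBq]
    calc 2 * ∫⁻ r in Ioo (0 : ℝ) 1,
          VarBergman.meanPow (P r) r (VarBergman.kernelFun w a q) * ENNReal.ofReal r
        ≤ 2 * (((max 1 C : ℝ≥0) : ℝ≥0∞) ^ ((B - q) / q) * (K * ∫⁻ r in Ioo (0 : ℝ) 1,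
          VarBergman.meanPow q r (VarBergman.kernelFun w a q) * ENNReal.ofReal r)) := by
          gcongr
          exact h1.trans (by gcongr)
      _ = ((max 1 C : ℝ≥0) : ℝ≥0∞) ^ ((B - q) / q) * K * (2 * ∫⁻ r in Ioo (0 : ℝ) 1,
          VarBergman.meanPow q r (VarBergman.kernelFun w a q) * ENNReal.ofReal r) := by ring
      _ ≤ _ := by gcongr
  tfae_have 10 → 9 := by
    intro h
    have h3 : 2 < 3 / q * q := by rw [div_mul_cancel₀ _ hq.ne']; norm_num
    exact ⟨3 / q, h3, h _ h3⟩
  tfae_have 9 → 8 := by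
    rintro ⟨a, ha, C, hC⟩
    obtain ⟨K, hK⟩ := VarBergman.exists_shell_bound_of_modular_kernelFun_le hq hP hPB hPq ha
      (C := C) fun w hw => by rw [← hmod]; exact hC w hw
    exact ⟨K, fun x hx hx1 => by rw [hWIcc x hx hx1]; exact hK x hx hx1⟩
  tfae_finish
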